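/- Let $-\infty<a<b<\infty$, $I=(a,b)$, $0<\beta,\gamma<1$. For $\lambda,\mu>-1$ put $\omega^{\lambda,\mu}(x)=(x-a)^{\lambda}(b-x)^{\mu}$, let $L_p(I,\lambda,\mu)$ be the (real) $L_p$ space on $I$ with respect to the measure $\omega^{\lambda,\mu}(x)\,dx$, and let $p_n^{\lambda,\mu}$, $n\ge 0$, be the orthonormal Jacobi polynomials for this measure (with positive leading coefficient), $$p_n^{\lambda,\mu}(x)=\delta_n\,(x-a)^{-\lambda}(b-x)^{-\mu}\frac{d^n}{dx^n}\big[(x-a)^{\lambda+n}(b-x)^{\mu+n}\big],\qquad \delta_n=\frac{(-1)^n}{(b-a)^{n+(\lambda+\mu+1)/2}}\sqrt{\frac{(\lambda+\mu+2n+1)\,\Gamma(\lambda+\mu+n+1)}{n!\,\Gamma(\lambda+n+1)\,\Gamma(\mu+n+1)}},$$ where for $n=0$ the product $(\lambda+\mu+1)\Gamma(\lambda+\mu+1)$ is read as $\Gamma(\lambda+\mu+2)$. Write $g_n(\lambda,\mu)=\int_a^b g\,p_n^{\lambda,\mu}\,\omega^{\lambda,\mu}\,dx$ for the Jacobi coefficients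 of $g$. Let $\varrho,\vartheta\in L_1(0,b-a)$ be real functions satisfying the Sonin condition $\int_0^x\varrho(x-t)\vartheta(t)\,dt=1$ for almost every $x\in(0,b-a)$, and put $(I^{\kappa}_{a+}g)(x)=\int_a^x\kappa(x-t)g(t)\,dt$. Let $f\in L_2(I,\beta,\gamma)$ be real. For $2\le p<\infty$ put $\xi=(5/2+\max\{\beta,\gamma\})(p-2)+2$ and consider the conditions: the coefficients $f^{\vartheta}_m:=(I^{\vartheta}_{a+}f)_m(\beta-1,\gamma-1)$ exist (that is, $I^{\vartheta}_{a+}f\in L_1(I,\beta-1,\gamma-1)$), and $$\sum_{n=1}^{\infty}|f^{\vartheta}_n|^p\,n^{\xi}<\infty,\qquad \sum_{m=0}^{\infty}f^{\vartheta}_m\,p_m^{\beta-1,\gamma-1}(a)=0. \tag{$*$}$$ (1) If $2\le p<\infty$ and $(*)$ holds, then the Abel–Sonin equation $I^{\varrho}_{a+}\varphi=f$ (almost everywhere on $I$) has a unique solution $\varphi\in L_p(I,\beta,\gamma)$. It is represented by its Jacobi series: $\varphi=\sum_{m=0}^{\infty}\varphi_m\,p_m^{\beta,\gamma}$ with convergence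 in $L_p(I,\beta,\gamma)$, where $\varphi_m=\varphi_m(\beta,\gamma)=\sqrt{(m+1)(\beta+\gamma+m)}\;f^{\vartheta}_{m+1}$. (2) For $p=2$ the conditions $(*)$ are also necessary: the equation has a solution in $L_2(I,\beta,\gamma)$ if and only if $(*)$ holds with $p=2$. -/

import Mathlib

open MeasureTheory Filter Topology Set

/-- The weighted measure `ω^{β,γ}(x) dx` on `I = (a,b)`, with `ω^{β,γ}(x) = (x-a)^β (b-x)^γ`.
The space `L_p(I,β,γ)` is `Lp ℝ p (jacobiMeasure a b β γ)`. -/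
noncomputable def jacobiMeasure (a b β γ : ℝ) : Measure ℝ :=
  (volume.restrict (Ioo a b)).withDensity
    (fun x => ENNReal.ofReal ((x - a) ^ β * (b - x) ^ γ))

/-- The normalizing constant `δ_n(β,γ)`. For `n = 0` the product
`(β+γ+1) Γ(β+γ+1)` is written `Γ(β+γ+2)`, its value also when `β+γ+1 = 0`. -/
noncomputable def jacobiDelta (a b β γ : ℝ) (n : ℕ) : ℝ :=
  (-1) ^ n / (b - a) ^ ((n : ℝ) + (β + γ + 1) / 2) *
    Real.sqrt
      ((if n = 0 then Real.Gamma (β + γ + 2)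
        else (β + γ + 2 * n + 1) * Real.Gamma (β + γ + n + 1)) /
        ((n.factorial : ℝ) * Real.Gamma (β + n + 1) * Real.Gamma (γ + n + 1)))

/-- The orthonormal Jacobi polynomial `p_n^{β,γ}` on `(a,b)`, as a polynomial function of `x ∈ ℝ`:
the Leibniz expansion of the Rodrigues formula (see `jacobiP_rodrigues`), which makes sense at the
end points as well. Here `(descPochhammer ℝ k).eval r = r (r-1) ⋯ (r-k+1)`. -/
noncomputable def jacobiP (a b β γ : ℝ) (n : ℕ) (x : ℝ) : ℝ :=
  jacobiDelta a b β γ n *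
    ∑ k ∈ Finset.range (n + 1), (n.choose k : ℝ) *
      ((descPochhammer ℝ k).eval (β + n) * (x - a) ^ (n - k)) *
      ((-1) ^ (n - k) * (descPochhammer ℝ (n - k)).eval (γ + n) * (b - x) ^ k)

/-- On `(a,b)` the function `jacobiP` is given by the Rodrigues formula. -/
theorem jacobiP_rodrigues (a b β γ : ℝ) (n : ℕ) (x : ℝ) (hx : x ∈ Ioo a b) :
    jacobiP a b β γ n x = jacobiDelta a b β γ n * (x - a) ^ (-β) * (b - x) ^ (-γ) *
      iteratedDeriv n (fun y => (y - a) ^ (β + n) * (b - y) ^ (γ + n)) x := by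
  have h1 : 0 < x - a := by linarith [hx.1]
  have h2 : 0 < b - x := by linarith [hx.2]
  have d1 : ContDiffAt ℝ n (fun y : ℝ => (y - a) ^ (β + n)) x :=
    (contDiffAt_id.sub contDiffAt_const).rpow_const_of_ne h1.ne'
  have d2 : ContDiffAt ℝ n (fun y : ℝ => (b - y) ^ (γ + n)) x :=
    (contDiffAt_const.sub contDiffAt_id).rpow_const_of_ne h2.ne'
  have e := iteratedDeriv_mul (n := n) d1 d2
  have e' : iteratedDeriv n (fun y => (y - a) ^ (β + n) * (b - y) ^ (γ + n)) x = _ := e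
  rw [e', jacobiP, mul_assoc, mul_assoc]
  congr 1
  rw [Finset.mul_sum, Finset.mul_sum]
  refine Finset.sum_congr rfl fun k hk => ?_
  have hk' : k ≤ n := Nat.lt_succ_iff.mp (Finset.mem_range.mp hk)
  have i1 : iteratedDeriv k (fun y : ℝ => (y - a) ^ (β + n)) x =
      (descPochhammer ℝ k).eval (β + n) * (x - a) ^ (β + n - k) := by
    rw [iteratedDeriv_comp_sub_const k (fun y : ℝ => y ^ (β + n)) a]
    rw [iteratedDeriv_eq_iterate]
    simp [Real.iter_deriv_rpow_const]
  have i2 : iteratedDeriv (n - k) (fun y : ℝ => (b - y) ^ (γ + n)) x =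
      (-1) ^ (n - k) * ((descPochhammer ℝ (n - k)).eval (γ + n) * (b - x) ^ (γ + k)) := by
    rw [iteratedDeriv_comp_const_sub (n - k) (fun y : ℝ => y ^ (γ + n)) b]
    rw [iteratedDeriv_eq_iterate]
    have e2 : γ + (n : ℝ) - ((n : ℝ) - k) = γ + k := by ring
    simp [Real.iter_deriv_rpow_const, Nat.cast_sub hk', e2]
  rw [i1, i2]
  have r1 : (x - a) ^ (n - k) = (x - a) ^ (-β) * (x - a) ^ (β + n - k) := by
    rw [← Real.rpow_add h1, ← Real.rpow_natCast, Nat.cast_sub hk']; congr 1; ring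
  have r2 : (b - x) ^ k = (b - x) ^ (-γ) * (b - x) ^ (γ + k) := by
    rw [← Real.rpow_add h2, ← Real.rpow_natCast]; congr 1; ring
  rw [r1, r2]
  ring

/-- The Jacobi coefficient `f_n(β,γ) = ∫_a^b f(x) p_n^{β,γ}(x) ω^{β,γ}(x) dx`. -/
noncomputable def jacobiCoeff (a b β γ : ℝ) (f : ℝ → ℝ) (n : ℕ) : ℝ :=
  ∫ x, f x * jacobiP a b β γ n x ∂(jacobiMeasure a b β γ)

/-- The functional `𝔅_p^{β,γ}(f,ξ) = ∑_{n ≥ 1} |f_n|^p n^ξ ∈ [0,∞]`. -/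
noncomputable def jacobiB (a b β γ p : ℝ) (f : ℝ → ℝ) (ξ : ℝ) : ENNReal :=
  ∑' n : ℕ, ENNReal.ofReal (|jacobiCoeff a b β γ f (n + 1)| ^ p * ((n : ℝ) + 1) ^ ξ)

/-- The operator `(I^κ_{a+} g)(x) = ∫_a^x κ(x-t) g(t) dt`. -/
noncomputable def soninI (κ : ℝ → ℝ) (a : ℝ) (g : ℝ → ℝ) (x : ℝ) : ℝ :=
  ∫ t in a..x, κ (x - t) * g t

/-- The Sonin condition `ϱ ∗ ϑ = 1` on `(0, b-a)`. -/
def SoninCondition (a b : ℝ) (ϱ ϑ : ℝ → ℝ) : Prop :=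
  ∀ᵐ x ∂(volume.restrict (Ioo 0 (b - a))), ∫ t in (0 : ℝ)..x, ϱ (x - t) * ϑ t = 1

/-- `φ` satisfies the Abel–Sonin equation `I^ϱ_{a+} φ = f` almost everywhere on `(a,b)`. -/
def SolvesAbelSonin (a b : ℝ) (ϱ φ f : ℝ → ℝ) : Prop :=
  ∀ᵐ x ∂(volume.restrict (Ioo a b)), soninI ϱ a φ x = f x

/-- The two conditions on the right-hand side `f`, for the exponent `p`, preceded by the
existence (as Lebesgue integrals) of the coefficients `f^ϑ_m = (I^ϑ_{a+} f)_m(β-1,γ-1)`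
that occur in them. -/
def SolvabilityConditions (a b β γ : ℝ) (ϑ f : ℝ → ℝ) (p : ℝ) : Prop :=
  Integrable (soninI ϑ a f) (jacobiMeasure a b (β - 1) (γ - 1)) ∧
  jacobiB a b (β - 1) (γ - 1) p (soninI ϑ a f) ((5 / 2 + max β γ) * (p - 2) + 2) < ⊤ ∧
  Tendsto (fun N : ℕ => ∑ m ∈ Finset.range N,
      jacobiCoeff a b (β - 1) (γ - 1) (soninI ϑ a f) m * jacobiP a b (β - 1) (γ - 1) m a)
    atTop (𝓝 0)

/-!
# Solvability of the Abel–Sonin equation in weighted `L_p` spaces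

Write `ω^{β,γ}(x) = (x-a)^β (b-x)^γ`, `G = I^ϑ f` and `s_m = √((m+1)(β+γ+m))`.

Since `ϱ ∗ ϑ = 1`, applying `I^ϑ` or `I^ϱ` shows that `I^ϱ φ = f` holds if and only if `G` is the
primitive `Φ(x) = ∫_a^x φ` (`solvesAbelSonin_iff`). Every `φ ∈ L_p(I,β,γ)` with `p ≥ 2` is integrable
on `I`, because `β, γ < 1`, so uniqueness is the uniqueness of the derivative.

Jacobi polynomials satisfy `(p_{m+1}^{β-1,γ-1})' = s_m p_m^{β,γ}`. If `∑ c_m p_m^{β,γ}` converges to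
`φ` in `L_p(I,β,γ)`, hence in `L₁(I)`, then its termwise primitive, which is the combination
`∑ (c_m / s_m) p_{m+1}^{β-1,γ-1}` minus its value at `a`, converges uniformly to `Φ`. Comparing Jacobi
coefficients for the parameters `(β-1,γ-1)` (`jacobiCoeff_primitive`) yields `Φ_{m+1} = c_m / s_m`,
and the coefficient of index zero yields `∑ Φ_m p_m^{β-1,γ-1}(a) = 0`. Conversely, a function in
`L₁(I,β-1,γ-1)` is determined by its Jacobi coefficients (`ae_eq_of_jacobiCoeff_eq`, by the
Weierstrass theorem), so if `c_m = s_m G_{m+1}` and `∑ G_m p_m^{β-1,γ-1}(a) = 0` then `G = Φ`.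

It remains to know when Jacobi series converge. For `p = 2` the Jacobi polynomials form a Hilbert
basis, and the summability condition is `∑ c_m² < ∞`. For `p > 2` one has
`|p_n^{β,γ}| ≤ M (n+1)^σ` with `σ = max β γ + 1/2` (`exists_abs_jacobiP_le`), and the Paley inequality
`‖∑ c_n p_n‖_p^p ≤ C ∑ |c_n|^p (n+1)^{(σ+1)(p-2)}` (`exists_integral_abs_sum_rpow_le`) applies to the
given condition since `s_n ≤ 2(n+1)`. The Paley inequality is proved without interpolation theory:
the sum is cut into dyadic blocks, the `p`-th power of the sum of the blocks is expanded into
products with two distinguished factors, these are estimated by orthogonality and the remaining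
factors uniformly, and a discrete Hardy inequality sums the result.
-/

/-! ### Derivative relations between Jacobi polynomials -/

/-- The sum in the definition of `jacobiP`: the Jacobi polynomial without its normalizing
constant. -/
noncomputable def jacobiRaw (a b β γ : ℝ) (n : ℕ) (x : ℝ) : ℝ :=
  ∑ k ∈ Finset.range (n + 1), (n.choose k : ℝ) *
      ((descPochhammer ℝ k).eval (β + n) * (x - a) ^ (n - k)) *
      ((-1) ^ (n - k) * (descPochhammer ℝ (n - k)).eval (γ + n) * (b - x) ^ k)

theorem jacobiP_eq (a b β γ : ℝ) (n : ℕ) (x : ℝ) :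
    jacobiP a b β γ n x = jacobiDelta a b β γ n * jacobiRaw a b β γ n x := rfl

/-- The termwise derivative of `jacobiRaw`. -/
noncomputable def jacobiRawDeriv (a b β γ : ℝ) (n : ℕ) (x : ℝ) : ℝ :=
  ∑ k ∈ Finset.range (n + 1), (n.choose k : ℝ) *
      (descPochhammer ℝ k).eval (β + n) * (-1) ^ (n - k) *
      (descPochhammer ℝ (n - k)).eval (γ + n) *
      ((n - k : ℕ) * (x - a) ^ (n - k - 1) * (b - x) ^ k -
        (x - a) ^ (n - k) * (k * (b - x) ^ (k - 1)))

theorem hasDerivAt_jacobiRaw (a b β γ : ℝ) (n : ℕ) (x : ℝ) :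
    HasDerivAt (jacobiRaw a b β γ n) (jacobiRawDeriv a b β γ n x) x := by
  unfold jacobiRaw jacobiRawDeriv
  refine HasDerivAt.fun_sum fun k _ => ?_
  have h1 : HasDerivAt (fun x => (x - a) ^ (n - k)) ((n - k : ℕ) * (x - a) ^ (n - k - 1) * 1) x :=
    ((hasDerivAt_id x).sub_const a).pow (n - k)
  have h2 : HasDerivAt (fun x => (b - x) ^ k) (k * (b - x) ^ (k - 1) * (-1)) x :=
    ((hasDerivAt_id x).const_sub b).pow k
  have h := (h1.mul h2).const_mul ((n.choose k : ℝ) *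
      (descPochhammer ℝ k).eval (β + n) * (-1) ^ (n - k) *
      (descPochhammer ℝ (n - k)).eval (γ + n))
  refine (h.congr_deriv (by ring)).congr_of_eventuallyEq (.of_forall fun y => ?_)
  simp only [Pi.mul_apply]
  ring

/-- Differentiation lowers the index and raises both parameters by one. -/
theorem jacobiRawDeriv_succ (a b β γ : ℝ) (n : ℕ) (x : ℝ) :
    jacobiRawDeriv a b (β - 1) (γ - 1) (n + 1) x =
      -((n + 1) * (β + γ + n)) * jacobiRaw a b β γ n x := by
  have hβ : β - 1 + ((n + 1 : ℕ) : ℝ) = β + n := by push_cast; ring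
  have hγ : γ - 1 + ((n + 1 : ℕ) : ℝ) = γ + n := by push_cast; ring
  unfold jacobiRawDeriv jacobiRaw
  simp only [hβ, hγ, mul_sub, Finset.sum_sub_distrib]
  rw [Finset.sum_range_succ, Finset.sum_range_succ' (n := n + 1)]
  simp only [Nat.cast_zero, zero_mul, mul_zero, add_zero, Nat.sub_self]
  rw [← Finset.sum_sub_distrib, Finset.mul_sum]
  refine Finset.sum_congr rfl fun k hk => ?_
  obtain ⟨j, rfl⟩ := Nat.exists_eq_add_of_le (Nat.lt_succ_iff.mp (Finset.mem_range.mp hk))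
  have e1 : k + j + 1 - k = j + 1 := by omega
  have e2 : k + j + 1 - (k + 1) = j := by omega
  have e3 : k + j - k = j := by omega
  have c1 : (((k + j + 1).choose k : ℕ) : ℝ) * (j + 1) = (k + j).choose k * (k + j + 1) := by
    have h := Nat.choose_mul_succ_eq (k + j) k
    rw [e1] at h
    exact_mod_cast h.symm
  have c2 : (((k + j + 1).choose (k + 1) : ℕ) : ℝ) * (k + 1) = (k + j).choose k * (k + j + 1) := by
    have h := Nat.add_one_mul_choose_eq (k + j) k
    rw [mul_comm] at h
    exact_mod_cast h.symm
  rw [e1, e2, e3, descPochhammer_succ_eval, descPochhammer_succ_eval]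
  simp only [Nat.add_sub_cancel, pow_succ]
  push_cast
  linear_combination
    ((descPochhammer ℝ k).eval (β + (k + j)) * (descPochhammer ℝ j).eval (γ + (k + j)) *
      (-1) ^ j * (x - a) ^ j * (b - x) ^ k) *
      (-(γ + (k + j) - j) * c1 - (β + (k + j) - k) * c2)

/-- The adjoint relation: differentiating `ω^{β,γ}` times the polynomial raises the index and lowers
both parameters by one. This is one step of the Rodrigues formula. -/
theorem jacobiRaw_raise (a b β γ : ℝ) (n : ℕ) (x : ℝ) :
    (x - a) * (b - x) * jacobiRawDeriv a b β γ n x +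
      (β * (b - x) - γ * (x - a)) * jacobiRaw a b β γ n x =
      jacobiRaw a b (β - 1) (γ - 1) (n + 1) x := by
  have hβ : β - 1 + ((n + 1 : ℕ) : ℝ) = β + n := by push_cast; ring
  have hγ : γ - 1 + ((n + 1 : ℕ) : ℝ) = γ + n := by push_cast; ring
  set B : ℕ → ℝ := fun k => (descPochhammer ℝ k).eval (β + n) with hB
  set C : ℕ → ℝ := fun k => (descPochhammer ℝ k).eval (γ + n) with hC
  have hBs : ∀ k, B (k + 1) = B k * (β + n - k) := fun k => descPochhammer_succ_eval k _
  have hCs : ∀ k, C (k + 1) = C k * (γ + n - k) := fun k => descPochhammer_succ_eval k _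
  have lhs : (x - a) * (b - x) * jacobiRawDeriv a b β γ n x +
      (β * (b - x) - γ * (x - a)) * jacobiRaw a b β γ n x =
      ∑ k ∈ Finset.range (n + 1), (n.choose k : ℝ) * B (k + 1) * (-1) ^ (n - k) * C (n - k) *
          ((x - a) ^ (n - k) * (b - x) ^ (k + 1)) +
      ∑ k ∈ Finset.range (n + 1), (n.choose k : ℝ) * B k * (-1) ^ (n + 1 - k) * C (n + 1 - k) *
          ((x - a) ^ (n + 1 - k) * (b - x) ^ k) := by
    unfold jacobiRawDeriv jacobiRaw
    rw [Finset.mul_sum, Finset.mul_sum, ← Finset.sum_add_distrib, ← Finset.sum_add_distrib]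
    refine Finset.sum_congr rfl fun k hk => ?_
    obtain ⟨j, rfl⟩ := Nat.exists_eq_add_of_le (Nat.lt_succ_iff.mp (Finset.mem_range.mp hk))
    have e1 : k + j + 1 - k = j + 1 := by omega
    have e3 : k + j - k = j := by omega
    have p1 : (j : ℝ) * ((x - a) * (x - a) ^ (j - 1)) = j * (x - a) ^ j := by
      rcases j with _ | j
      · simp
      · simp [pow_succ']
    have p2 : (k : ℝ) * ((b - x) * (b - x) ^ (k - 1)) = k * (b - x) ^ k := by
      rcases k with _ | k
      · simp
      · simp [pow_succ']
    rw [e1, e3, hBs, hCs]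
    change _ * (_ * B k * _ * C j * _) + _ * (_ * (B k * _) * (_ * C j * _)) = _
    simp only [pow_succ]
    push_cast
    linear_combination ((k + j).choose k : ℝ) * B k * (-1) ^ j * C j *
      ((b - x) * (b - x) ^ k * p1 - (x - a) * (x - a) ^ j * p2)
  rw [lhs]
  unfold jacobiRaw
  simp only [hβ, hγ]
  change _ = ∑ k ∈ Finset.range (n + 1 + 1), ((n + 1).choose k : ℝ) *
      (B k * (x - a) ^ (n + 1 - k)) * ((-1) ^ (n + 1 - k) * C (n + 1 - k) * (b - x) ^ k)
  rw [Finset.sum_range_succ' _ (n + 1)]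
  have hsplit : ∑ k ∈ Finset.range (n + 1), (n.choose k : ℝ) * B k * (-1) ^ (n + 1 - k) *
        C (n + 1 - k) * ((x - a) ^ (n + 1 - k) * (b - x) ^ k) =
      ∑ k ∈ Finset.range (n + 1), (n.choose (k + 1) : ℝ) * B (k + 1) * (-1) ^ (n - k) *
        C (n - k) * ((x - a) ^ (n - k) * (b - x) ^ (k + 1)) +
      (-1) ^ (n + 1) * C (n + 1) * B 0 * (x - a) ^ (n + 1) := by
    rw [Finset.sum_range_succ', Finset.sum_range_succ _ n]
    simp only [Nat.choose_succ_self, Nat.cast_zero, zero_mul, add_zero, Nat.choose_zero_right,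
      Nat.cast_one, Nat.add_sub_add_right, Nat.sub_zero, pow_zero, mul_one, one_mul]
    ring
  rw [hsplit, ← add_assoc, ← Finset.sum_add_distrib]
  congr 1
  · refine Finset.sum_congr rfl fun k _ => ?_
    rw [Nat.choose_succ_succ, Nat.add_sub_add_right]
    push_cast
    ring
  · simp only [Nat.choose_zero_right, Nat.cast_one, Nat.sub_zero, pow_zero]
    ring

/-- The factor `√((n+1)(β+γ+n))` in the derivative relations for Jacobi polynomials. -/
noncomputable def jacobiS (β γ : ℝ) (n : ℕ) : ℝ := Real.sqrt (((n : ℝ) + 1) * (β + γ + n))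

theorem jacobiS_pos {β γ : ℝ} (h : 0 < β + γ) (n : ℕ) : 0 < jacobiS β γ n :=
  Real.sqrt_pos.mpr (by positivity)

theorem jacobiS_sq {β γ : ℝ} (h : 0 < β + γ) (n : ℕ) :
    jacobiS β γ n ^ 2 = ((n : ℝ) + 1) * (β + γ + n) :=
  Real.sq_sqrt (by positivity)

theorem jacobiDelta_eq {a b β γ : ℝ} (hab : a < b) (hβ : 0 < β) (hγ : 0 < γ) (n : ℕ) :
    jacobiDelta a b β γ n = -jacobiS β γ n * jacobiDelta a b (β - 1) (γ - 1) (n + 1) := by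
  have hba : 0 < b - a := sub_pos.mpr hab
  unfold jacobiDelta jacobiS
  have e1 : ((n + 1 : ℕ) : ℝ) + (β - 1 + (γ - 1) + 1) / 2 = n + (β + γ + 1) / 2 := by
    push_cast; ring
  have g1 : (if n = 0 then Real.Gamma (β + γ + 2)
        else (β + γ + 2 * n + 1) * Real.Gamma (β + γ + n + 1)) =
        (β + γ + 2 * n + 1) * ((β + γ + n) * Real.Gamma (β + γ + n)) := by
    split_ifs with h
    · subst h
      rw [← Real.Gamma_add_one (by positivity)]
      have : β + γ + 2 = (β + γ + 1) + 1 := by ring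
      rw [this, Real.Gamma_add_one (by positivity)]
      simp
    · rw [← Real.Gamma_add_one (by positivity)]
  have e2 : β - 1 + (γ - 1) + 2 * ((n + 1 : ℕ) : ℝ) + 1 = β + γ + 2 * n + 1 := by push_cast; ring
  have e3 : β - 1 + (γ - 1) + ((n + 1 : ℕ) : ℝ) + 1 = β + γ + n := by push_cast; ring
  have e4 : β - 1 + ((n + 1 : ℕ) : ℝ) + 1 = β + n + 1 := by push_cast; ring
  have e5 : γ - 1 + ((n + 1 : ℕ) : ℝ) + 1 = γ + n + 1 := by push_cast; ring
  rw [g1, e1, if_neg (Nat.succ_ne_zero n), e2, e3, e4, e5]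
  have G1 : 0 < Real.Gamma (β + γ + n) := Real.Gamma_pos_of_pos (by positivity)
  have G2 : 0 < Real.Gamma (β + n + 1) := Real.Gamma_pos_of_pos (by positivity)
  have G3 : 0 < Real.Gamma (γ + n + 1) := Real.Gamma_pos_of_pos (by positivity)
  have : ((n : ℝ) + 1) * (β + γ + n) * ((β + γ + 2 * n + 1) * Real.Gamma (β + γ + n) /
      (((n + 1).factorial : ℝ) * Real.Gamma (β + n + 1) * Real.Gamma (γ + n + 1))) =
      (β + γ + 2 * n + 1) * ((β + γ + n) * Real.Gamma (β + γ + n)) /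
      ((n.factorial : ℝ) * Real.Gamma (β + n + 1) * Real.Gamma (γ + n + 1)) := by
    have : (n.factorial : ℝ) ≠ 0 := by positivity
    rw [Nat.factorial_succ]
    push_cast
    field_simp
  rw [← this, Real.sqrt_mul (by positivity), pow_succ]
  ring

/-- The derivative of `p_{n+1}^{β-1,γ-1}` is `√((n+1)(β+γ+n)) p_n^{β,γ}`. -/
theorem hasDerivAt_jacobiP_succ {a b β γ : ℝ} (hab : a < b) (hβ : 0 < β) (hγ : 0 < γ) (n : ℕ)
    (x : ℝ) :
    HasDerivAt (jacobiP a b (β - 1) (γ - 1) (n + 1)) (jacobiS β γ n * jacobiP a b β γ n x) x := by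
  have h := (hasDerivAt_jacobiRaw a b (β - 1) (γ - 1) (n + 1) x).const_mul
    (jacobiDelta a b (β - 1) (γ - 1) (n + 1))
  refine h.congr_deriv ?_
  rw [jacobiRawDeriv_succ, jacobiP_eq, jacobiDelta_eq hab hβ hγ, ← jacobiS_sq (by positivity)]
  ring

/-- The derivative of `p_n`, computed termwise. -/
noncomputable def jacobiPDeriv (a b β γ : ℝ) (n : ℕ) (x : ℝ) : ℝ :=
  jacobiDelta a b β γ n * jacobiRawDeriv a b β γ n x

theorem hasDerivAt_jacobiP (a b β γ : ℝ) (n : ℕ) (x : ℝ) :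
    HasDerivAt (jacobiP a b β γ n) (jacobiPDeriv a b β γ n x) x :=
  (hasDerivAt_jacobiRaw a b β γ n x).const_mul _

/-- Up to the weight, this is `(ω^{β,γ} p_n^{β,γ})' = -√((n+1)(β+γ+n)) ω^{β-1,γ-1} p_{n+1}^{β-1,γ-1}`,
multiplied out so that no powers of real exponent occur. -/
theorem jacobiP_raise {a b β γ : ℝ} (hab : a < b) (hβ : 0 < β) (hγ : 0 < γ) (n : ℕ) (x : ℝ) :
    (x - a) * (b - x) * jacobiPDeriv a b β γ n x +
      (β * (b - x) - γ * (x - a)) * jacobiP a b β γ n x =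
      -jacobiS β γ n * jacobiP a b (β - 1) (γ - 1) (n + 1) x := by
  have h := jacobiRaw_raise a b β γ n x
  rw [jacobiPDeriv, jacobiP_eq, jacobiP_eq, jacobiDelta_eq hab hβ hγ]
  linear_combination -jacobiS β γ n * jacobiDelta a b (β - 1) (γ - 1) (n + 1) * h

theorem continuous_jacobiP (a b β γ : ℝ) (n : ℕ) : Continuous (jacobiP a b β γ n) := by
  unfold jacobiP; fun_prop

theorem continuous_jacobiPDeriv (a b β γ : ℝ) (n : ℕ) : Continuous (jacobiPDeriv a b β γ n) := by
  unfold jacobiPDeriv jacobiRawDeriv; fun_prop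

theorem jacobiP_zero_pos {a b β γ : ℝ} (hab : a < b) (hβ : -1 < β) (hγ : -1 < γ) (x : ℝ) :
    0 < jacobiP a b β γ 0 x := by
  have hba : 0 < b - a := sub_pos.mpr hab
  have G1 : 0 < Real.Gamma (β + γ + 2) := Real.Gamma_pos_of_pos (by linarith)
  have G2 : 0 < Real.Gamma (β + 1) := Real.Gamma_pos_of_pos (by linarith)
  have G3 : 0 < Real.Gamma (γ + 1) := Real.Gamma_pos_of_pos (by linarith)
  simp only [jacobiP, jacobiDelta]
  simp
  positivity

theorem jacobiP_zero_eq (a b β γ x y : ℝ) : jacobiP a b β γ 0 x = jacobiP a b β γ 0 y := by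
  simp [jacobiP]

/-- Every polynomial of degree at most `n` is a combination of `p_0, …, p_n`. The induction passes
to the derivative, raising both parameters by one. -/
theorem exists_eq_sum_jacobiP {a b : ℝ} (hab : a < b) (n : ℕ) : ∀ {β γ : ℝ}, -1 < β → -1 < γ →
    ∀ q : Polynomial ℝ, q.natDegree ≤ n → ∃ c : ℕ → ℝ, ∀ x,
      q.eval x = ∑ k ∈ Finset.range (n + 1), c k * jacobiP a b β γ k x := by
  have key : ∀ {β γ : ℝ}, -1 < β → -1 < γ → ∀ (q : Polynomial ℝ) (m : ℕ) (c : ℕ → ℝ),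
      (∀ x, q.derivative.eval x = ∑ k ∈ Finset.range m, c k * jacobiP a b (β + 1) (γ + 1) k x) →
      ∃ c : ℕ → ℝ, ∀ x,
      q.eval x = ∑ k ∈ Finset.range (m + 1), c k * jacobiP a b β γ k x := by
    intro β γ hβ hγ q m c hc
    set d : ℕ → ℝ := fun k => c k / jacobiS (β + 1) (γ + 1) k
    have hs : ∀ k, jacobiS (β + 1) (γ + 1) k ≠ 0 := fun k =>
      (jacobiS_pos (by linarith) k).ne'
    set D : ℝ → ℝ := fun x => q.eval x - ∑ k ∈ Finset.range m, d k * jacobiP a b β γ (k + 1) x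
    have hD : ∀ x, HasDerivAt D 0 x := by
      intro x
      have h1 := q.hasDerivAt x
      have h2 : HasDerivAt (fun x => ∑ k ∈ Finset.range m, d k * jacobiP a b β γ (k + 1) x)
          (∑ k ∈ Finset.range m, d k *
            (jacobiS (β + 1) (γ + 1) k * jacobiP a b (β + 1) (γ + 1) k x)) x := by
        refine HasDerivAt.fun_sum fun k _ => HasDerivAt.const_mul _ ?_
        have := hasDerivAt_jacobiP_succ (β := β + 1) (γ := γ + 1) hab (by linarith) (by linarith)
          k x
        simpa using this
      refine (h1.sub h2).congr_deriv ?_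
      rw [hc, ← Finset.sum_sub_distrib]
      refine Finset.sum_eq_zero fun k _ => ?_
      simp only [d]
      field_simp [hs k]
      ring
    have hconst : ∀ x, D x = D a := fun x =>
      is_const_of_deriv_eq_zero (fun x => (hD x).differentiableAt) (fun x => (hD x).deriv) x a
    refine ⟨fun k => if k = 0 then D a / jacobiP a b β γ 0 a else d (k - 1), fun x => ?_⟩
    rw [Finset.sum_range_succ']
    simp only [Nat.succ_ne_zero, if_false, if_true, Nat.add_sub_cancel]
    rw [jacobiP_zero_eq a b β γ x a, div_mul_cancel₀ _ (jacobiP_zero_pos hab hβ hγ a).ne',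
      ← hconst x]
    simp only [D]
    ring
  induction n with
  | zero =>
    intro β γ hβ hγ q hq
    refine key hβ hγ q 0 (fun _ => 0) fun x => ?_
    rw [Polynomial.eq_C_of_natDegree_le_zero hq]
    simp
  | succ n ih =>
    intro β γ hβ hγ q hq
    obtain ⟨c, hc⟩ := ih (β := β + 1) (γ := γ + 1) (by linarith) (by linarith) q.derivative
      (by have := q.natDegree_derivative_le; omega)
    exact key hβ hγ q (n + 1) c hc

/-! ### The Jacobi measure -/

/-- The weight `ω^{β,γ}(x) = (x-a)^β (b-x)^γ`. -/
noncomputable def jacobiWeight (a b β γ x : ℝ) : ℝ := (x - a) ^ β * (b - x) ^ γ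

theorem jacobiWeight_pos {a b β γ x : ℝ} (hx : x ∈ Ioo a b) : 0 < jacobiWeight a b β γ x :=
  mul_pos (Real.rpow_pos_of_pos (sub_pos.mpr hx.1) _) (Real.rpow_pos_of_pos (sub_pos.mpr hx.2) _)

theorem measurable_jacobiWeight (a b β γ : ℝ) : Measurable (jacobiWeight a b β γ) := by
  unfold jacobiWeight; fun_prop

theorem jacobiWeight_eq_mul {a b β γ x : ℝ} (hx : x ∈ Ioo a b) :
    jacobiWeight a b β γ x = (x - a) * (b - x) * jacobiWeight a b (β - 1) (γ - 1) x := by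
  have h1 : x - a ≠ 0 := (sub_pos.mpr hx.1).ne'
  have h2 : b - x ≠ 0 := (sub_pos.mpr hx.2).ne'
  unfold jacobiWeight
  rw [Real.rpow_sub_one h1, Real.rpow_sub_one h2]
  field_simp

theorem jacobiMeasure_eq (a b β γ : ℝ) : jacobiMeasure a b β γ =
    (volume.restrict (Ioo a b)).withDensity fun x => ENNReal.ofReal (jacobiWeight a b β γ x) := rfl

theorem ae_jacobiMeasure_iff {a b β γ : ℝ} {q : ℝ → Prop} :
    (∀ᵐ x ∂(jacobiMeasure a b β γ), q x) ↔ ∀ᵐ x ∂(volume.restrict (Ioo a b)), q x := by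
  rw [jacobiMeasure_eq]
  constructor
  · have h := withDensity_absolutelyContinuous' (μ := volume.restrict (Ioo a b))
      (f := fun x => ENNReal.ofReal (jacobiWeight a b β γ x))
      (measurable_jacobiWeight a b β γ).ennreal_ofReal.aemeasurable
      (by
        filter_upwards [ae_restrict_mem measurableSet_Ioo] with x hx
        simpa using jacobiWeight_pos hx)
    exact fun hq => h.ae_le hq
  · exact fun hq => (withDensity_absolutelyContinuous _ _).ae_le hq

theorem ae_mem_jacobiMeasure (a b β γ : ℝ) : ∀ᵐ x ∂(jacobiMeasure a b β γ), x ∈ Ioo a b :=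
  ae_jacobiMeasure_iff.mpr (ae_restrict_mem measurableSet_Ioo)

theorem aestronglyMeasurable_jacobiMeasure_iff {a b β γ : ℝ} {f : ℝ → ℝ} :
    AEStronglyMeasurable f (jacobiMeasure a b β γ) ↔
      AEStronglyMeasurable f (volume.restrict (Ioo a b)) := by
  constructor
  · rintro ⟨g, hg, h⟩
    exact ⟨g, hg, ae_jacobiMeasure_iff.mp h⟩
  · rintro ⟨g, hg, h⟩
    exact ⟨g, hg, ae_jacobiMeasure_iff.mpr h⟩

theorem lintegral_jacobiMeasure (a b β γ : ℝ) (f : ℝ → ENNReal) :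
    ∫⁻ x, f x ∂(jacobiMeasure a b β γ) =
      ∫⁻ x in Ioo a b, ENNReal.ofReal (jacobiWeight a b β γ x) * f x := by
  rw [jacobiMeasure_eq, lintegral_withDensity_eq_lintegral_mul_non_measurable]
  · rfl
  · exact (measurable_jacobiWeight a b β γ).ennreal_ofReal
  · exact .of_forall fun x => ENNReal.ofReal_lt_top

theorem integral_jacobiMeasure (a b β γ : ℝ) (f : ℝ → ℝ) :
    ∫ x, f x ∂(jacobiMeasure a b β γ) = ∫ x in Ioo a b, jacobiWeight a b β γ x * f x := by
  rw [jacobiMeasure_eq, integral_withDensity_eq_integral_toReal_smul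
    (measurable_jacobiWeight a b β γ).ennreal_ofReal (.of_forall fun x => ENNReal.ofReal_lt_top)]
  refine setIntegral_congr_fun measurableSet_Ioo fun x hx => ?_
  simp only [ENNReal.toReal_ofReal (jacobiWeight_pos hx).le, smul_eq_mul]

theorem integrable_jacobiMeasure_iff {a b β γ : ℝ} {f : ℝ → ℝ} :
    Integrable f (jacobiMeasure a b β γ) ↔
      IntegrableOn (fun x => jacobiWeight a b β γ x * f x) (Ioo a b) := by
  rw [jacobiMeasure_eq, integrable_withDensity_iff_integrable_smul'
    (measurable_jacobiWeight a b β γ).ennreal_ofReal (.of_forall fun x => ENNReal.ofReal_lt_top)]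
  refine integrableOn_congr_fun (fun x hx => ?_) measurableSet_Ioo
  simp only [ENNReal.toReal_ofReal (jacobiWeight_pos hx).le, smul_eq_mul]

/-- The total mass of the Jacobi measure is a scaled Beta integral. -/
theorem jacobiMeasure_univ {a b β γ : ℝ} (hab : a < b) (hβ : -1 < β) (hγ : -1 < γ) :
    jacobiMeasure a b β γ univ = ENNReal.ofReal ((b - a) ^ (β + γ + 1) *
      (Real.Gamma (β + 1) * Real.Gamma (γ + 1) / Real.Gamma (β + γ + 2))) := by
  have hba : 0 < b - a := sub_pos.mpr hab
  have hB := ProbabilityTheory.beta_pos (α := β + 1) (β := γ + 1) (by linarith) (by linarith)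
  have h1 := ProbabilityTheory.lintegral_betaPDF_eq_one (α := β + 1) (β := γ + 1)
    (by linarith) (by linarith)
  rw [ProbabilityTheory.lintegral_betaPDF] at h1
  have himg : (fun t => a + (b - a) * t) '' Ioo (0 : ℝ) 1 = Ioo a b := by
    ext y
    constructor
    · rintro ⟨t, ⟨h0, h1⟩, rfl⟩
      constructor <;> simp only <;> nlinarith
    · rintro ⟨h0, h1⟩
      refine ⟨(y - a) / (b - a), ⟨div_pos (by linarith) hba, ?_⟩, ?_⟩
      · rw [div_lt_one hba]; linarith
      · simp only; field_simp; ring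
  have h2 : ∫⁻ x in Ioo a b, ENNReal.ofReal (jacobiWeight a b β γ x) =
      ∫⁻ t in Ioo (0 : ℝ) 1, ENNReal.ofReal ((b - a) ^ (β + γ + 1) *
        ProbabilityTheory.beta (β + 1) (γ + 1)) * ENNReal.ofReal
        (1 / ProbabilityTheory.beta (β + 1) (γ + 1) * t ^ (β + 1 - 1) * (1 - t) ^ (γ + 1 - 1)) := by
    rw [← himg, lintegral_image_eq_lintegral_abs_deriv_mul (f' := fun _ => b - a)
      measurableSet_Ioo (fun x _ => by
        have := ((hasDerivAt_id x).const_mul (b - a)).const_add a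
        simpa using this.hasDerivWithinAt)
      (fun x _ y _ h => by
        simp only [add_right_inj] at h
        exact mul_left_cancel₀ hba.ne' h)]
    refine setLIntegral_congr_fun measurableSet_Ioo fun t ht => ?_
    have ht0 : 0 < t := ht.1
    have ht1 : 0 < 1 - t := by linarith [ht.2]
    rw [abs_of_pos hba, ← ENNReal.ofReal_mul hba.le, ← ENNReal.ofReal_mul (by positivity)]
    congr 1
    unfold jacobiWeight
    have e1 : a + (b - a) * t - a = (b - a) * t := by ring
    have e2 : b - (a + (b - a) * t) = (b - a) * (1 - t) := by ring
    rw [e1, e2, Real.mul_rpow hba.le ht0.le, Real.mul_rpow hba.le ht1.le,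
      Real.rpow_add hba, Real.rpow_add hba, Real.rpow_one, add_sub_cancel_right,
      add_sub_cancel_right]
    field_simp
  have h3 := lintegral_jacobiMeasure a b β γ 1
  simp only [Pi.one_apply, mul_one, lintegral_one] at h3
  rw [h3, h2, lintegral_const_mul' _ _ ENNReal.ofReal_ne_top, h1, mul_one]
  congr 2
  unfold ProbabilityTheory.beta
  congr 2
  ring

theorem isFiniteMeasure_jacobiMeasure {a b β γ : ℝ} (hab : a < b) (hβ : -1 < β) (hγ : -1 < γ) :
    IsFiniteMeasure (jacobiMeasure a b β γ) :=
  ⟨by rw [jacobiMeasure_univ hab hβ hγ]; exact ENNReal.ofReal_lt_top⟩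

theorem integrable_jacobiMeasure_of_bounded {a b β γ : ℝ} (hab : a < b) (hβ : -1 < β)
    (hγ : -1 < γ) {f : ℝ → ℝ} (hf : AEStronglyMeasurable f (volume.restrict (Ioo a b))) {C : ℝ}
    (hC : ∀ x ∈ Ioo a b, |f x| ≤ C) : Integrable f (jacobiMeasure a b β γ) := by
  have := isFiniteMeasure_jacobiMeasure hab hβ hγ
  exact Integrable.of_bound (aestronglyMeasurable_jacobiMeasure_iff.mpr hf) C
    ((ae_mem_jacobiMeasure a b β γ).mono fun x hx => hC x hx)

theorem integrable_jacobiMeasure_of_continuous {a b β γ : ℝ} (hab : a < b) (hβ : -1 < β)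
    (hγ : -1 < γ) {f : ℝ → ℝ} (hf : Continuous f) : Integrable f (jacobiMeasure a b β γ) := by
  obtain ⟨C, hC⟩ := (isCompact_Icc (a := a) (b := b)).exists_bound_of_continuousOn hf.continuousOn
  exact integrable_jacobiMeasure_of_bounded hab hβ hγ hf.aestronglyMeasurable
    fun x hx => hC x (Ioo_subset_Icc_self hx)

/-! ### Orthonormality -/

/-- Integration by parts for the Jacobi weights; the boundary terms vanish since `ω^{β,γ}` does. -/
theorem integral_jacobi_by_parts {a b β γ : ℝ} (hab : a < b) (hβ : 0 < β) (hγ : 0 < γ)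
    {q q' m m' : ℝ → ℝ} (hq : ∀ x, HasDerivAt q (q' x) x) (hm : ∀ x, HasDerivAt m (m' x) x)
    (hq' : Continuous q') (hm' : Continuous m') :
    ∫ x, ((x - a) * (b - x) * q' x + (β * (b - x) - γ * (x - a)) * q x) * m x
        ∂(jacobiMeasure a b (β - 1) (γ - 1)) = -∫ x, q x * m' x ∂(jacobiMeasure a b β γ) := by
  have hqc : Continuous q := continuous_iff_continuousAt.mpr fun x => (hq x).continuousAt
  have hmc : Continuous m := continuous_iff_continuousAt.mpr fun x => (hm x).continuousAt
  set A : ℝ → ℝ := fun x => ((x - a) * (b - x) * q' x + (β * (b - x) - γ * (x - a)) * q x) * m x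
  have hA : Continuous A := by fun_prop
  have hB : Continuous fun x => q x * m' x := by fun_prop
  have iA := integrable_jacobiMeasure_iff.mp
    (integrable_jacobiMeasure_of_continuous (β := β - 1) (γ := γ - 1) hab
      (by linarith) (by linarith) hA)
  have iB := integrable_jacobiMeasure_iff.mp
    (integrable_jacobiMeasure_of_continuous (β := β) (γ := γ) hab (by linarith) (by linarith) hB)
  rw [integral_jacobiMeasure, integral_jacobiMeasure, eq_neg_iff_add_eq_zero,
    ← integral_add iA iB, ← integral_Ioc_eq_integral_Ioo,
    ← intervalIntegral.integral_of_le hab.le]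
  set F : ℝ → ℝ := fun x => ((x - a) ^ β * (b - x) ^ γ) * (q x * m x)
  have hF := intervalIntegral.integral_eq_sub_of_hasDerivAt_of_le (f := F)
    (f' := fun x => jacobiWeight a b (β - 1) (γ - 1) x * A x +
      jacobiWeight a b β γ x * (q x * m' x)) hab.le ?_ ?_ ?_
  · rw [hF]
    simp [F, Real.zero_rpow hβ.ne', Real.zero_rpow hγ.ne']
  · refine Continuous.continuousOn ?_
    have h1 : Continuous fun x : ℝ => (x - a) ^ β :=
      (continuous_id.sub continuous_const).rpow_const fun x => Or.inr hβ.le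
    have h2 : Continuous fun x : ℝ => (b - x) ^ γ :=
      (continuous_const.sub continuous_id).rpow_const fun x => Or.inr hγ.le
    exact (h1.mul h2).mul (hqc.mul hmc)
  · intro x hx
    have u0 : x - a ≠ 0 := (sub_pos.mpr hx.1).ne'
    have v0 : b - x ≠ 0 := (sub_pos.mpr hx.2).ne'
    have h1 : HasDerivAt (fun x : ℝ => (x - a) ^ β) (1 * β * (x - a) ^ (β - 1)) x :=
      ((hasDerivAt_id x).sub_const a).rpow_const (Or.inl u0)
    have h2 : HasDerivAt (fun x : ℝ => (b - x) ^ γ) (-1 * γ * (b - x) ^ (γ - 1)) x :=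
      ((hasDerivAt_id x).const_sub b).rpow_const (Or.inl v0)
    have h := (h1.mul h2).mul ((hq x).mul (hm x))
    refine h.congr_deriv ?_
    simp only [Pi.mul_apply]
    rw [jacobiWeight_eq_mul (β := β) (γ := γ) hx]
    simp only [jacobiWeight, A]
    have r1 : (x - a) ^ β = (x - a) * (x - a) ^ (β - 1) := by
      rw [Real.rpow_sub_one u0]; field_simp
    have r2 : (b - x) ^ γ = (b - x) * (b - x) ^ (γ - 1) := by
      rw [Real.rpow_sub_one v0]; field_simp
    rw [r1, r2]
    ring
  · rw [intervalIntegrable_iff_integrableOn_Ioo_of_le hab.le]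
    exact iA.add iB

theorem integral_jacobiP_succ_mul {a b β γ : ℝ} (hab : a < b) (hβ : 0 < β) (hγ : 0 < γ) (n : ℕ)
    {m m' : ℝ → ℝ} (hm : ∀ x, HasDerivAt m (m' x) x) (hm' : Continuous m') :
    jacobiS β γ n * ∫ x, jacobiP a b (β - 1) (γ - 1) (n + 1) x * m x
        ∂(jacobiMeasure a b (β - 1) (γ - 1)) =
      ∫ x, jacobiP a b β γ n x * m' x ∂(jacobiMeasure a b β γ) := by
  have h := integral_jacobi_by_parts hab hβ hγ (hasDerivAt_jacobiP a b β γ n) hm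
    (continuous_jacobiPDeriv a b β γ n) hm'
  rw [← neg_inj, ← h, ← integral_const_mul, ← integral_neg]
  refine integral_congr_ae (.of_forall fun x => ?_)
  simp only
  rw [jacobiP_raise hab hβ hγ]
  ring

theorem jacobiP_zero_sq {a b β γ : ℝ} (hab : a < b) (hβ : -1 < β) (hγ : -1 < γ) (x : ℝ) :
    jacobiP a b β γ 0 x * jacobiP a b β γ 0 x * (jacobiMeasure a b β γ).real univ = 1 := by
  have hba : 0 < b - a := sub_pos.mpr hab
  have G1 : 0 < Real.Gamma (β + γ + 2) := Real.Gamma_pos_of_pos (by linarith)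
  have G2 : 0 < Real.Gamma (β + 1) := Real.Gamma_pos_of_pos (by linarith)
  have G3 : 0 < Real.Gamma (γ + 1) := Real.Gamma_pos_of_pos (by linarith)
  rw [Measure.real, jacobiMeasure_univ hab hβ hγ, ENNReal.toReal_ofReal (by positivity)]
  have e : jacobiP a b β γ 0 x = ((b - a) ^ ((β + γ + 1) / 2))⁻¹ *
      Real.sqrt (Real.Gamma (β + γ + 2) / (Real.Gamma (β + 1) * Real.Gamma (γ + 1))) := by
    simp [jacobiP, jacobiDelta]
  have e2 : (b - a) ^ (β + γ + 1) = (b - a) ^ ((β + γ + 1) / 2) * (b - a) ^ ((β + γ + 1) / 2) := by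
    rw [← Real.rpow_add hba]; congr 1; ring
  have e3 := Real.mul_self_sqrt
    (show 0 ≤ Real.Gamma (β + γ + 2) / (Real.Gamma (β + 1) * Real.Gamma (γ + 1)) by positivity)
  have P : 0 < (b - a) ^ ((β + γ + 1) / 2) := Real.rpow_pos_of_pos hba _
  rw [e, e2]
  generalize Real.sqrt (Real.Gamma (β + γ + 2) / (Real.Gamma (β + 1) * Real.Gamma (γ + 1))) = s
    at e3 ⊢
  have : s * s * (Real.Gamma (β + 1) * Real.Gamma (γ + 1) / Real.Gamma (β + γ + 2)) = 1 := by
    rw [e3]; field_simp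
  conv_rhs => rw [← this]
  field_simp

/-- The Jacobi polynomials are orthonormal. Integration by parts lowers both indices and raises
both parameters, until one index is zero. -/
theorem integral_jacobiP_mul_jacobiP {a b : ℝ} (hab : a < b) (n : ℕ) : ∀ (m : ℕ) {β γ : ℝ},
    -1 < β → -1 < γ →
    ∫ x, jacobiP a b β γ n x * jacobiP a b β γ m x ∂(jacobiMeasure a b β γ) =
      if n = m then 1 else 0 := by
  have zero : ∀ (n : ℕ) {β γ : ℝ}, -1 < β → -1 < γ →
      ∫ x, jacobiP a b β γ (n + 1) x * jacobiP a b β γ 0 x ∂(jacobiMeasure a b β γ) = 0 := by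
    intro n β γ hβ hγ
    have h := integral_jacobiP_succ_mul (β := β + 1) (γ := γ + 1) hab (by linarith) (by linarith) n
      (m := fun _ => jacobiP a b β γ 0 a) (m' := fun _ => 0)
      (fun x => hasDerivAt_const x _) continuous_const
    simp only [add_sub_cancel_right, mul_zero, integral_zero, mul_eq_zero,
      (jacobiS_pos (show 0 < β + 1 + (γ + 1) by linarith) n).ne', false_or] at h
    rw [← h]
    exact integral_congr_ae (.of_forall fun x => by simp only; rw [jacobiP_zero_eq a b β γ x a])
  induction n with
  | zero =>
    intro m β γ hβ hγ
    rcases m with _ | m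
    · rw [if_pos rfl, ← jacobiP_zero_sq hab hβ hγ a]
      have : ∀ x, jacobiP a b β γ 0 x = jacobiP a b β γ 0 a :=
        fun x => jacobiP_zero_eq a b β γ x a
      simp only [this, integral_const, smul_eq_mul]
      ring
    · simp only [mul_comm (jacobiP a b β γ 0 _)]
      simpa using zero m hβ hγ
  | succ n ih =>
    intro m β γ hβ hγ
    rcases m with _ | m
    · simpa using zero n hβ hγ
    · have hs : ∀ k, jacobiS (β + 1) (γ + 1) k ≠ 0 := fun k =>
        (jacobiS_pos (show 0 < β + 1 + (γ + 1) by linarith) k).ne'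
      have h := integral_jacobiP_succ_mul (β := β + 1) (γ := γ + 1) hab (by linarith)
        (by linarith) n (hasDerivAt_jacobiP_succ (β := β + 1) (γ := γ + 1) hab (by linarith)
        (by linarith) m) (continuous_const.mul (continuous_jacobiP _ _ _ _ _))
      simp only [mul_left_comm _ (jacobiS _ _ m)] at h
      rw [integral_const_mul, ih m (by linarith) (by linarith)] at h
      simp only [add_sub_cancel_right] at h
      by_cases hnm : n = m
      · subst hnm
        simp only [if_true] at h ⊢
        exact mul_left_cancel₀ (hs n) h
      · simp only [hnm, if_false, mul_zero, mul_eq_zero, hs, false_or] at h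
        simpa [hnm] using h

/-! ### A uniform bound for Jacobi polynomials -/

/-- On `[a,b]` a Jacobi polynomial with nonnegative parameters is largest at one of the end points.
This follows from Sonin's auxiliary function `F = p² + (x-a)(b-x) q²`, where `p` is the polynomial
and `q` its normalized derivative: `F' = q² ((2γ+1)(x-a) - (2β+1)(b-x))` changes sign only once. -/
theorem jacobiP_sq_le_max {a b β γ : ℝ} (hab : a < b) (hβ : 0 ≤ β) (hγ : 0 ≤ γ) (n : ℕ) {x : ℝ}
    (hx : x ∈ Icc a b) :
    jacobiP a b β γ n x ^ 2 ≤ max (jacobiP a b β γ n a ^ 2) (jacobiP a b β γ n b ^ 2) := by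
  rcases n with _ | n
  · rw [jacobiP_zero_eq a b β γ x a]
    exact le_max_left _ _
  set P := jacobiP a b β γ (n + 1)
  set Q := jacobiP a b (β + 1) (γ + 1) n
  set s := jacobiS (β + 1) (γ + 1) n
  have hP : ∀ y, HasDerivAt P (s * Q y) y := fun y => by
    have := hasDerivAt_jacobiP_succ (β := β + 1) (γ := γ + 1) hab (by linarith) (by linarith) n y
    simpa only [add_sub_cancel_right] using this
  have hQ := hasDerivAt_jacobiP a b (β + 1) (γ + 1) n
  have hode : ∀ y, (y - a) * (b - y) * jacobiPDeriv a b (β + 1) (γ + 1) n y +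
      ((β + 1) * (b - y) - (γ + 1) * (y - a)) * Q y = -s * P y := fun y => by
    have := jacobiP_raise (β := β + 1) (γ := γ + 1) hab (by linarith) (by linarith) n y
    simpa only [add_sub_cancel_right] using this
  set F : ℝ → ℝ := fun y => P y ^ 2 + (y - a) * (b - y) * Q y ^ 2
  have hF : ∀ y, HasDerivAt F (Q y ^ 2 * ((2 * γ + 1) * (y - a) - (2 * β + 1) * (b - y))) y := by
    intro y
    have h1 : HasDerivAt (fun y => (y - a) * (b - y)) (1 * (b - y) + (y - a) * (-1)) y :=
      ((hasDerivAt_id y).sub_const a).mul ((hasDerivAt_id y).const_sub b)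
    have h := ((hP y).pow 2).add (h1.mul ((hQ y).pow 2))
    refine h.congr_deriv ?_
    simp only [Pi.pow_apply, Nat.cast_ofNat, Nat.add_one_sub_one, pow_one]
    change 2 * P y * (s * Q y) + ((1 * (b - y) + (y - a) * (-1)) * Q y ^ 2 +
      (y - a) * (b - y) * (2 * Q y * jacobiPDeriv a b (β + 1) (γ + 1) n y)) = _
    linear_combination 2 * Q y * hode y
  have hFd : Differentiable ℝ F := fun y => (hF y).differentiableAt
  have hle : P x ^ 2 ≤ F x := by
    have : 0 ≤ (x - a) * (b - x) * Q x ^ 2 :=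
      mul_nonneg (mul_nonneg (by linarith [hx.1]) (by linarith [hx.2])) (sq_nonneg _)
    simp only [F]; linarith
  refine hle.trans ?_
  rcases le_total ((2 * γ + 1) * (x - a) - (2 * β + 1) * (b - x)) 0 with hsgn | hsgn
  · have hanti : AntitoneOn F (Icc a x) := by
      refine antitoneOn_of_deriv_nonpos (convex_Icc a x) hFd.continuous.continuousOn
        hFd.differentiableOn fun y hy => ?_
      rw [interior_Icc] at hy
      rw [(hF y).deriv]
      refine mul_nonpos_of_nonneg_of_nonpos (sq_nonneg _) (le_trans ?_ hsgn)
      have := hy.2.le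
      gcongr
    have := hanti (left_mem_Icc.mpr hx.1) (right_mem_Icc.mpr hx.1) hx.1
    refine this.trans (le_trans (le_of_eq ?_) (le_max_left _ _))
    simp [F]
  · have hmono : MonotoneOn F (Icc x b) := by
      refine monotoneOn_of_deriv_nonneg (convex_Icc x b) hFd.continuous.continuousOn
        hFd.differentiableOn fun y hy => ?_
      rw [interior_Icc] at hy
      rw [(hF y).deriv]
      refine mul_nonneg (sq_nonneg _) (le_trans hsgn ?_)
      have := hy.1.le
      gcongr
    have := hmono (left_mem_Icc.mpr hx.2) (right_mem_Icc.mpr hx.2) hx.2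
    refine this.trans (le_trans (le_of_eq ?_) (le_max_right _ _))
    simp [F]

theorem Gamma_add_le {x s : ℝ} (hx : 0 < x) (hs : 0 < s) (hs1 : s < 1) :
    Real.Gamma (x + s) ≤ Real.Gamma x * x ^ s := by
  have h := Real.Gamma_mul_add_mul_le_rpow_Gamma_mul_rpow_Gamma (s := x) (t := x + 1)
    (a := 1 - s) (b := s) hx (by linarith) (by linarith) hs (by ring)
  have e : (1 - s) * x + s * (x + 1) = x + s := by ring
  have G := Real.Gamma_pos_of_pos hx
  rw [e, Real.Gamma_add_one hx.ne', Real.mul_rpow hx.le G.le, mul_left_comm,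
    ← Real.rpow_add G, sub_add_cancel, Real.rpow_one] at h
  linarith

theorem descPochhammer_eval_add_nat {β : ℝ} (hβ : -1 < β) (n : ℕ) :
    (descPochhammer ℝ n).eval (β + n) = Real.Gamma (β + n + 1) / Real.Gamma (β + 1) := by
  rw [descPochhammer_eval_eq_ascPochhammer]
  have e : β + n - n + 1 = β + 1 := by ring
  rw [e, eq_div_iff (Real.Gamma_pos_of_pos (by linarith)).ne']
  induction n with
  | zero => simp
  | succ n ih =>
    have hn : (0 : ℝ) ≤ n := n.cast_nonneg
    rw [ascPochhammer_succ_eval, mul_right_comm, ih (by ring)]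
    push_cast
    rw [← add_assoc β, Real.Gamma_add_one (s := β + n + 1) (by linarith)]
    ring

theorem jacobiDelta_comm (a b β γ : ℝ) (n : ℕ) :
    jacobiDelta a b β γ n = jacobiDelta a b γ β n := by
  unfold jacobiDelta
  rw [add_comm γ β, mul_right_comm]

theorem jacobiP_left (a b β γ : ℝ) (n : ℕ) : jacobiP a b β γ n a =
    jacobiDelta a b β γ n * ((descPochhammer ℝ n).eval (β + n) * (b - a) ^ n) := by
  unfold jacobiP
  rw [Finset.sum_eq_single n]
  · simp
  · intro k hk hkn
    have : n - k ≠ 0 := by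
      have := Finset.mem_range.mp hk; omega
    simp [this]
  · simp

theorem jacobiP_right (a b β γ : ℝ) (n : ℕ) : jacobiP a b β γ n b =
    (-1) ^ n * (jacobiDelta a b γ β n * ((descPochhammer ℝ n).eval (γ + n) * (b - a) ^ n)) := by
  rw [jacobiDelta_comm]
  unfold jacobiP
  rw [Finset.sum_eq_single 0]
  · simp; ring
  · intro k _ hk
    simp [hk]
  · simp

/-- The values at the end points are given by Gamma functions, whose quotients are estimated by
logarithmic convexity. -/
theorem jacobiDelta_mul_descPochhammer_sq_le {a b β γ : ℝ} (hab : a < b) (hβ₀ : 0 < β)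
    (hβ₁ : β < 1) (hγ₀ : 0 < γ) (hγ₁ : γ < 1) (n : ℕ) :
    (jacobiDelta a b β γ n * ((descPochhammer ℝ n).eval (β + n) * (b - a) ^ n)) ^ 2 ≤
      6 * ((b - a) ^ (β + γ + 1) * Real.Gamma (β + 1) ^ 2)⁻¹ * ((n : ℝ) + 1) ^ (2 * β + 1) := by
  have hba : 0 < b - a := sub_pos.mpr hab
  have hn : (0 : ℝ) ≤ n := n.cast_nonneg
  have g1 : (if n = 0 then Real.Gamma (β + γ + 2)
        else (β + γ + 2 * n + 1) * Real.Gamma (β + γ + n + 1)) =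
        (β + γ + 2 * n + 1) * Real.Gamma (β + γ + n + 1) := by
    split_ifs with h
    · subst h
      have : β + γ + 2 = (β + γ + 1) + 1 := by ring
      rw [this, Real.Gamma_add_one (by positivity)]
      simp
    · rfl
  have G1 : 0 < Real.Gamma (β + γ + n + 1) := Real.Gamma_pos_of_pos (by positivity)
  have G2 : 0 < Real.Gamma (β + n + 1) := Real.Gamma_pos_of_pos (by positivity)
  have G3 : 0 < Real.Gamma (γ + n + 1) := Real.Gamma_pos_of_pos (by positivity)
  have G4 : 0 < Real.Gamma (β + 1) := Real.Gamma_pos_of_pos (by positivity)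
  have e0 : ((b - a) ^ ((n : ℝ) + (β + γ + 1) / 2)) ^ 2 =
      (b - a) ^ (β + γ + 1) * ((b - a) ^ n) ^ 2 := by
    rw [← Real.rpow_natCast, ← Real.rpow_mul hba.le, ← pow_mul, ← Real.rpow_natCast (b - a),
      ← Real.rpow_add hba]
    congr 1
    push_cast
    ring
  have K : 0 < (b - a) ^ (β + γ + 1) := Real.rpow_pos_of_pos hba _
  have e1 : (jacobiDelta a b β γ n * ((descPochhammer ℝ n).eval (β + n) * (b - a) ^ n)) ^ 2 =
      ((b - a) ^ (β + γ + 1) * Real.Gamma (β + 1) ^ 2)⁻¹ * ((β + γ + 2 * n + 1) *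
        (Real.Gamma (β + γ + n + 1) / Real.Gamma (γ + n + 1)) *
        (Real.Gamma (β + n + 1) / n.factorial)) := by
    rw [descPochhammer_eval_add_nat (by linarith)]
    unfold jacobiDelta
    rw [g1, mul_pow, mul_pow, Real.sq_sqrt (by positivity), div_pow, e0, ← pow_mul, mul_comm n 2,
      pow_mul]
    have : (n.factorial : ℝ) ≠ 0 := by positivity
    norm_num
    field_simp
  have f1 : Real.Gamma (β + γ + n + 1) / Real.Gamma (γ + n + 1) ≤ 2 * ((n : ℝ) + 1) ^ β := by
    rw [div_le_iff₀ G3]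
    have h := Gamma_add_le (x := γ + n + 1) (by positivity) hβ₀ hβ₁
    have e : γ + n + 1 + β = β + γ + n + 1 := by ring
    rw [e, mul_comm] at h
    refine h.trans ?_
    gcongr
    calc (γ + n + 1) ^ β ≤ (2 * ((n : ℝ) + 1)) ^ β :=
          Real.rpow_le_rpow (by positivity) (by linarith) hβ₀.le
      _ = 2 ^ β * ((n : ℝ) + 1) ^ β := Real.mul_rpow (by norm_num) (by positivity)
      _ ≤ 2 ^ (1 : ℝ) * ((n : ℝ) + 1) ^ β := by
          gcongr
          norm_num
      _ = _ := by rw [Real.rpow_one]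
  have f2 : Real.Gamma (β + n + 1) / n.factorial ≤ ((n : ℝ) + 1) ^ β := by
    rw [div_le_iff₀ (by positivity), ← Real.Gamma_nat_eq_factorial, mul_comm]
    have h := Gamma_add_le (x := (n : ℝ) + 1) (by positivity) hβ₀ hβ₁
    have e : (n : ℝ) + 1 + β = β + n + 1 := by ring
    rwa [e] at h
  have f3 : ((n : ℝ) + 1) ^ (2 * β + 1) = ((n : ℝ) + 1) * ((n : ℝ) + 1) ^ β * ((n : ℝ) + 1) ^ β := by
    rw [two_mul, Real.rpow_add (by positivity), Real.rpow_add (by positivity), Real.rpow_one]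
    ring
  rw [e1, f3]
  calc _ ≤ ((b - a) ^ (β + γ + 1) * Real.Gamma (β + 1) ^ 2)⁻¹ * ((3 * ((n : ℝ) + 1)) *
        (2 * ((n : ℝ) + 1) ^ β) * ((n : ℝ) + 1) ^ β) := by
        gcongr
        linarith
    _ = _ := by ring

theorem exists_abs_jacobiP_le {a b β γ : ℝ} (hab : a < b) (hβ₀ : 0 < β) (hβ₁ : β < 1)
    (hγ₀ : 0 < γ) (hγ₁ : γ < 1) : ∃ M : ℝ, 0 ≤ M ∧ ∀ (n : ℕ), ∀ x ∈ Icc a b,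
      |jacobiP a b β γ n x| ≤ M * ((n : ℝ) + 1) ^ (max β γ + 1 / 2) := by
  have hba : 0 < b - a := sub_pos.mpr hab
  set K₁ := 6 * ((b - a) ^ (β + γ + 1) * Real.Gamma (β + 1) ^ 2)⁻¹
  set K₂ := 6 * ((b - a) ^ (γ + β + 1) * Real.Gamma (γ + 1) ^ 2)⁻¹
  have hK₁ : 0 ≤ K₁ := by positivity
  have hK₂ : 0 ≤ K₂ := by positivity
  refine ⟨Real.sqrt (K₁ + K₂), Real.sqrt_nonneg _, fun n x hx => ?_⟩
  have hn : (1 : ℝ) ≤ (n : ℝ) + 1 := by linarith [n.cast_nonneg (α := ℝ)]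
  refine abs_le_of_sq_le_sq ?_ (by positivity)
  have e : (((n : ℝ) + 1) ^ (max β γ + 1 / 2)) ^ 2 = ((n : ℝ) + 1) ^ (2 * max β γ + 1) := by
    rw [← Real.rpow_natCast, ← Real.rpow_mul (by linarith)]
    congr 1
    push_cast
    ring
  rw [mul_pow, Real.sq_sqrt (by positivity), e]
  refine (jacobiP_sq_le_max hab hβ₀.le hγ₀.le n hx).trans (max_le ?_ ?_)
  · rw [jacobiP_left]
    refine (jacobiDelta_mul_descPochhammer_sq_le hab hβ₀ hβ₁ hγ₀ hγ₁ n).trans ?_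
    have : ((n : ℝ) + 1) ^ (2 * β + 1) ≤ ((n : ℝ) + 1) ^ (2 * max β γ + 1) :=
      Real.rpow_le_rpow_of_exponent_le hn (by linarith [le_max_left β γ])
    gcongr
    linarith
  · rw [jacobiP_right, mul_pow, ← pow_mul, mul_comm n 2, pow_mul, neg_one_sq, one_pow, one_mul]
    refine (jacobiDelta_mul_descPochhammer_sq_le hab hγ₀ hγ₁ hβ₀ hβ₁ n).trans ?_
    have : ((n : ℝ) + 1) ^ (2 * γ + 1) ≤ ((n : ℝ) + 1) ^ (2 * max β γ + 1) :=
      Real.rpow_le_rpow_of_exponent_le hn (by linarith [le_max_right β γ])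
    gcongr
    linarith

/-! ### A Paley inequality for orthonormal systems -/

theorem sum_range_rpow_le {p : ℝ} (hp : 1 ≤ p) {x : ℕ → ℝ} (hx : ∀ k, 0 ≤ x k) (K : ℕ) :
    (∑ k ∈ Finset.range K, x k) ^ p ≤
      p * ∑ k ∈ Finset.range K, x k * (∑ i ∈ Finset.range (k + 1), x i) ^ (p - 1) := by
  induction K with
  | zero => simp [Real.zero_rpow (by linarith : p ≠ 0)]
  | succ K ih =>
    rw [Finset.sum_range_succ (fun k => x k * _), mul_add]
    set s := ∑ k ∈ Finset.range K, x k
    have hs : 0 ≤ s := Finset.sum_nonneg fun k _ => hx k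
    have e : ∑ k ∈ Finset.range (K + 1), x k = s + x K := Finset.sum_range_succ _ _
    rw [e]
    refine le_trans ?_ (add_le_add_left ih _)
    rcases (add_nonneg hs (hx K)).eq_or_lt with h0 | h0
    · rw [← h0, Real.zero_rpow (by linarith : p ≠ 0)]
      have := hx K
      positivity
    -- Bernoulli's inequality for the quotient of consecutive partial sums
    · have hB := one_add_mul_self_le_rpow_one_add (s := -(x K / (s + x K))) (p := p)
        (by rw [neg_le_neg_iff, div_le_one h0]; linarith) hp
      have e1 : 1 + -(x K / (s + x K)) = s / (s + x K) := by field_simp; ring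
      rw [e1, Real.div_rpow hs h0.le, le_div_iff₀ (Real.rpow_pos_of_pos h0 _)] at hB
      have e2 : (s + x K) ^ p = (s + x K) * (s + x K) ^ (p - 1) := by
        rw [Real.rpow_sub_one h0.ne']; field_simp
      have e3 : (1 + p * -(x K / (s + x K))) * (s + x K) ^ p =
          (s + x K) ^ p - p * (x K * (s + x K) ^ (p - 1)) := by
        rw [e2]; field_simp; ring
      linarith

/-- The `p`-th power of a sum, expanded so that two factors are singled out whose indices are not
smaller than any other. -/
theorem sum_range_rpow_le_double {p : ℝ} (hp : 2 ≤ p) {x : ℕ → ℝ} (hx : ∀ k, 0 ≤ x k) (K : ℕ) :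
    (∑ k ∈ Finset.range K, x k) ^ p ≤ p * (p - 1) * ∑ k ∈ Finset.range K,
      ∑ j ∈ Finset.range (k + 1), x k * x j * (∑ i ∈ Finset.range (j + 1), x i) ^ (p - 2) := by
  refine (sum_range_rpow_le (by linarith) hx K).trans ?_
  rw [mul_assoc, Finset.mul_sum (a := p - 1)]
  refine mul_le_mul_of_nonneg_left (Finset.sum_le_sum fun k _ => ?_) (by linarith)
  have h := sum_range_rpow_le (p := p - 1) (by linarith) hx (k + 1)
  have e : p - 1 - 1 = p - 2 := by ring
  rw [e] at h
  refine (mul_le_mul_of_nonneg_left h (hx k)).trans (le_of_eq ?_)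
  rw [mul_left_comm, Finset.mul_sum]
  simp only [mul_assoc]

theorem sum_geometric_conv_le {r : ℝ} (hr0 : 0 ≤ r) (hr1 : r < 1) {v : ℕ → ℝ}
    (hv : ∀ k, 0 ≤ v k) (K : ℕ) :
    ∑ k ∈ Finset.range K, ∑ j ∈ Finset.range (k + 1), r ^ (k - j) * v j ≤
      (1 - r)⁻¹ * ∑ k ∈ Finset.range K, v k := by
  set S : ℕ → ℝ := fun k => ∑ j ∈ Finset.range (k + 1), r ^ (k - j) * v j
  have hS : ∀ k, 0 ≤ S k := fun k =>
    Finset.sum_nonneg fun j _ => mul_nonneg (pow_nonneg hr0 _) (hv j)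
  have hrec : ∀ k, S (k + 1) = r * S k + v (k + 1) := by
    intro k
    simp only [S]
    rw [Finset.sum_range_succ, Finset.mul_sum]
    simp only [Nat.sub_self, pow_zero, one_mul]
    congr 1
    refine Finset.sum_congr rfl fun j hj => ?_
    have : k + 1 - j = k - j + 1 := by have := Finset.mem_range.mp hj; omega
    rw [this, pow_succ]; ring
  have key : ∀ K, (1 - r) * ∑ k ∈ Finset.range (K + 1), S k + r * S K =
      ∑ k ∈ Finset.range (K + 1), v k := by
    intro K
    induction K with
    | zero => simp [S]; ring
    | succ K ih =>
      rw [Finset.sum_range_succ S, Finset.sum_range_succ v, ← ih, hrec]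
      ring
  rcases K with _ | K
  · simp
  · change ∑ k ∈ Finset.range (K + 1), S k ≤ _
    rw [← key K, mul_add, inv_mul_cancel_left₀ (by linarith)]
    have : 0 ≤ (1 - r)⁻¹ * (r * S K) :=
      mul_nonneg (inv_nonneg.mpr (by linarith)) (mul_nonneg hr0 (hS K))
    linarith

theorem sum_geometric_le {r : ℝ} (hr0 : 0 ≤ r) (hr1 : r < 1) (k : ℕ) :
    ∑ j ∈ Finset.range (k + 1), r ^ (k - j) ≤ (1 - r)⁻¹ := by
  have h := Finset.sum_range_reflect (fun j => r ^ j) (k + 1)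
  simp only [Nat.add_sub_cancel] at h
  rw [h, ← tsum_geometric_of_lt_one hr0 hr1]
  exact (summable_geometric_of_lt_one hr0 hr1).sum_le_tsum _ fun i _ => pow_nonneg hr0 i

theorem mul_mul_rpow_le_add {p x y z : ℝ} (hp : 2 ≤ p) (hx : 0 ≤ x) (hy : 0 ≤ y) (hz : 0 ≤ z) :
    x * y * z ^ (p - 2) ≤ x ^ p + y ^ p + z ^ p := by
  set m := max x (max y z)
  have hxm : x ≤ m := le_max_left _ _
  have hym : y ≤ m := (le_max_left _ _).trans (le_max_right _ _)
  have hzm : z ≤ m := (le_max_right _ _).trans (le_max_right _ _)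
  have hm : 0 ≤ m := hx.trans hxm
  have h1 : x * y * z ^ (p - 2) ≤ m * m * m ^ (p - 2) := by
    have : 0 ≤ p - 2 := by linarith
    gcongr
  have h2 : m * m * m ^ (p - 2) = m ^ p := by
    rw [← pow_two, ← Real.rpow_natCast, ← Real.rpow_add_of_nonneg hm (by norm_num) (by linarith)]
    congr 1
    push_cast
    ring
  have hx' := Real.rpow_nonneg hx p
  have hy' := Real.rpow_nonneg hy p
  have hz' := Real.rpow_nonneg hz p
  rw [h2] at h1
  refine h1.trans ?_
  rcases max_choice x (max y z) with h | h
  · simp only [m, h]; linarith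
  · rcases max_choice y z with h' | h' <;> simp only [m, h, h'] <;> linarith

/-- A discrete Hardy inequality: in the normalization `b_k = D^{k(p-2)/p} a_k` the double sum has
the geometrically decaying kernel `D^{-(k-j)(p-2)/p}`. -/
theorem exists_double_sum_le {D p : ℝ} (hD : 1 < D) (hp : 2 < p) :
    ∃ C : ℝ, 0 ≤ C ∧ ∀ (a : ℕ → ℝ), (∀ k, 0 ≤ a k) → ∀ K : ℕ,
      ∑ k ∈ Finset.range K, ∑ j ∈ Finset.range (k + 1),
        a k * a j * (∑ i ∈ Finset.range (j + 1), D ^ i * a i) ^ (p - 2) ≤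
      C * ∑ k ∈ Finset.range K, (D ^ k) ^ (p - 2) * a k ^ p := by
  have hD0 : 0 < D := by linarith
  have hp0 : 0 < p := by linarith
  set θ : ℝ := (p - 2) / p
  set η : ℝ := 2 / p
  have hθ : 0 < θ := div_pos (by linarith) hp0
  have hη : 0 < η := by positivity
  have hθη : θ + η = 1 := by simp only [θ, η]; field_simp; ring
  set r := D ^ (-θ)
  set q := D ^ (-η)
  have hr0 : 0 ≤ r := (Real.rpow_pos_of_pos hD0 _).le
  have hq0 : 0 ≤ q := (Real.rpow_pos_of_pos hD0 _).le
  have hr1 : r < 1 := Real.rpow_lt_one_of_one_lt_of_neg hD (by linarith)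
  have hq1 : q < 1 := Real.rpow_lt_one_of_one_lt_of_neg hD (by linarith)
  have hr' : 0 ≤ (1 - r)⁻¹ := inv_nonneg.mpr (by linarith)
  have hq' : 0 ≤ (1 - q)⁻¹ := inv_nonneg.mpr (by linarith)
  refine ⟨(1 - r)⁻¹ * (2 + ((1 - q)⁻¹) ^ (p - 1) * (1 - q)⁻¹), by positivity, fun a ha K => ?_⟩
  set b : ℕ → ℝ := fun k => (D ^ k) ^ θ * a k
  have hb : ∀ k, 0 ≤ b k := fun k => mul_nonneg (by positivity) (ha k)
  have hbp : ∀ k, b k ^ p = (D ^ k) ^ (p - 2) * a k ^ p := by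
    intro k
    simp only [b]
    rw [Real.mul_rpow (by positivity) (ha k), ← Real.rpow_mul (by positivity)]
    congr 2
    simp only [θ]
    field_simp
  set h : ℕ → ℝ := fun j => ∑ i ∈ Finset.range (j + 1), q ^ (j - i) * b i
  have hh : ∀ j, 0 ≤ h j := fun j =>
    Finset.sum_nonneg fun i _ => mul_nonneg (pow_nonneg hq0 _) (hb i)
  have hpow : ∀ (t : ℝ) {i j : ℕ}, i ≤ j → (D ^ (-t)) ^ (j - i) * (D ^ j) ^ t = (D ^ i) ^ t := by
    intro t i j hij
    obtain ⟨d, rfl⟩ := Nat.exists_eq_add_of_le hij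
    rw [Nat.add_sub_cancel_left, pow_add, Real.mul_rpow (by positivity) (by positivity),
      Real.rpow_neg hD0.le, ← Real.rpow_natCast D d, ← Real.rpow_mul hD0.le, mul_comm (d : ℝ),
      Real.rpow_mul hD0.le, Real.rpow_natCast]
    rw [inv_pow, mul_left_comm, inv_mul_cancel₀ (by positivity), mul_one]
  have hsum : ∀ j, ∑ i ∈ Finset.range (j + 1), D ^ i * a i = (D ^ j) ^ η * h j := by
    intro j
    simp only [h]
    rw [Finset.mul_sum]
    refine Finset.sum_congr rfl fun i hi => ?_
    have hij : i ≤ j := Nat.lt_succ_iff.mp (Finset.mem_range.mp hi)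
    have e : D ^ i = (D ^ i) ^ η * (D ^ i) ^ θ := by
      rw [← Real.rpow_add (by positivity), add_comm, hθη, Real.rpow_one]
    calc D ^ i * a i = (D ^ i) ^ η * (D ^ i) ^ θ * a i := by rw [← e]
      _ = _ := by
        rw [← hpow η hij]
        simp only [b, q]
        ring
  have hterm : ∀ {k j : ℕ}, j ≤ k →
      a k * a j * (∑ i ∈ Finset.range (j + 1), D ^ i * a i) ^ (p - 2) =
        r ^ (k - j) * (b k * b j * h j ^ (p - 2)) := by
    intro k j hjk
    rw [hsum, Real.mul_rpow (by positivity) (hh j), ← Real.rpow_mul (by positivity)]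
    have e : η * (p - 2) = θ + θ := by simp only [η, θ]; ring
    have e2 := hpow θ hjk
    rw [e, Real.rpow_add (by positivity)]
    simp only [b, r]
    rw [← e2]
    ring
  have hJ : ∀ j, h j ^ p ≤ ((1 - q)⁻¹) ^ (p - 1) *
      ∑ i ∈ Finset.range (j + 1), q ^ (j - i) * b i ^ p := by
    intro j
    have h1 := Real.inner_le_weight_mul_Lp_of_nonneg (Finset.range (j + 1)) (p := p)
      (by linarith) (fun i => q ^ (j - i)) b (fun i => pow_nonneg hq0 _) hb
    have hw : 0 ≤ ∑ i ∈ Finset.range (j + 1), q ^ (j - i) :=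
      Finset.sum_nonneg fun i _ => pow_nonneg hq0 _
    have hv : 0 ≤ ∑ i ∈ Finset.range (j + 1), q ^ (j - i) * b i ^ p :=
      Finset.sum_nonneg fun i _ => mul_nonneg (pow_nonneg hq0 _) (Real.rpow_nonneg (hb i) _)
    have h2 := Real.rpow_le_rpow (hh j) h1 hp0.le
    rw [Real.mul_rpow (by positivity) (by positivity), ← Real.rpow_mul hw, ← Real.rpow_mul hv,
      inv_mul_cancel₀ hp0.ne', Real.rpow_one] at h2
    have e : (1 - p⁻¹) * p = p - 1 := by field_simp
    rw [e] at h2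
    refine h2.trans (mul_le_mul_of_nonneg_right ?_ hv)
    exact Real.rpow_le_rpow hw (sum_geometric_le hq0 hq1 j) (by linarith)
  have hB : ∀ k, 0 ≤ b k ^ p := fun k => Real.rpow_nonneg (hb k) p
  set T := ∑ k ∈ Finset.range K, b k ^ p
  calc ∑ k ∈ Finset.range K, ∑ j ∈ Finset.range (k + 1),
        a k * a j * (∑ i ∈ Finset.range (j + 1), D ^ i * a i) ^ (p - 2)
      ≤ ∑ k ∈ Finset.range K, ∑ j ∈ Finset.range (k + 1),
        (r ^ (k - j) * b k ^ p + r ^ (k - j) * b j ^ p + r ^ (k - j) * h j ^ p) := by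
        refine Finset.sum_le_sum fun k _ => Finset.sum_le_sum fun j hj => ?_
        rw [hterm (Nat.lt_succ_iff.mp (Finset.mem_range.mp hj)), ← mul_add, ← mul_add]
        exact mul_le_mul_of_nonneg_left (mul_mul_rpow_le_add hp.le (hb k) (hb j) (hh j))
          (pow_nonneg hr0 _)
    _ = ∑ k ∈ Finset.range K, ∑ j ∈ Finset.range (k + 1), r ^ (k - j) * b k ^ p +
        ∑ k ∈ Finset.range K, ∑ j ∈ Finset.range (k + 1), r ^ (k - j) * b j ^ p +
        ∑ k ∈ Finset.range K, ∑ j ∈ Finset.range (k + 1), r ^ (k - j) * h j ^ p := by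
        simp only [Finset.sum_add_distrib]
    _ ≤ (1 - r)⁻¹ * T + (1 - r)⁻¹ * T +
        (1 - r)⁻¹ * (((1 - q)⁻¹) ^ (p - 1) * ((1 - q)⁻¹ * T)) := by
        refine add_le_add (add_le_add ?_ (sum_geometric_conv_le hr0 hr1 hB K)) ?_
        · rw [Finset.mul_sum]
          refine Finset.sum_le_sum fun k _ => ?_
          rw [← Finset.sum_mul]
          exact mul_le_mul_of_nonneg_right (sum_geometric_le hr0 hr1 k) (hB k)
        · refine (sum_geometric_conv_le hr0 hr1 (fun k => Real.rpow_nonneg (hh k) p) K).trans ?_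
          refine mul_le_mul_of_nonneg_left ?_ hr'
          refine (Finset.sum_le_sum fun j _ => hJ j).trans ?_
          rw [← Finset.mul_sum]
          exact mul_le_mul_of_nonneg_left (sum_geometric_conv_le hq0 hq1 hB K) (by positivity)
    _ = _ := by
        simp only [T, hbp]
        ring

theorem integral_sq_sum_orthonormal {α : Type*} [MeasurableSpace α] {μ : Measure α}
    {e : ℕ → α → ℝ} (he : ∀ n, MemLp (e n) 2 μ)
    (horth : ∀ n m, ∫ x, e n x * e m x ∂μ = if n = m then 1 else 0) (F : Finset ℕ) (c : ℕ → ℝ) :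
    ∫ x, (∑ n ∈ F, c n * e n x) ^ 2 ∂μ = ∑ n ∈ F, c n ^ 2 := by
  have hint : ∀ n m, Integrable (fun x => e n x * e m x) μ := fun n m =>
    (he n).integrable_mul (he m)
  have h1 : ∀ x, (∑ n ∈ F, c n * e n x) ^ 2 =
      ∑ n ∈ F, ∑ m ∈ F, c n * c m * (e n x * e m x) := by
    intro x
    rw [pow_two, Finset.sum_mul_sum]
    exact Finset.sum_congr rfl fun n _ => Finset.sum_congr rfl fun m _ => by ring
  simp only [h1]
  rw [integral_finsetSum _ fun n _ => integrable_finsetSum _ fun m _ => (hint n m).const_mul _]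
  refine Finset.sum_congr rfl fun n hn => ?_
  rw [integral_finsetSum _ fun m _ => (hint n m).const_mul _]
  simp only [integral_const_mul, horth, mul_ite, mul_one, mul_zero]
  rw [Finset.sum_ite_eq F n, if_pos hn, pow_two]

theorem integral_abs_mul_abs_le {α : Type*} [MeasurableSpace α] {μ : Measure α} {f g : α → ℝ}
    (hf : MemLp f 2 μ) (hg : MemLp g 2 μ) :
    ∫ x, |f x| * |g x| ∂μ ≤ Real.sqrt (∫ x, f x ^ 2 ∂μ) * Real.sqrt (∫ x, g x ^ 2 ∂μ) := by
  have h := integral_mul_norm_le_Lp_mul_Lq (μ := μ) (f := f) (g := g) (p := 2) (q := 2)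
    Real.HolderConjugate.two_two (by simpa using hf) (by simpa using hg)
  simp only [Real.norm_eq_abs] at h
  refine h.trans (le_of_eq ?_)
  rw [Real.sqrt_eq_rpow, Real.sqrt_eq_rpow]
  norm_num

/-- The dyadic block of the indices `n ∈ F` with `2^k ≤ n + 1 < 2^{k+1}`. -/
def dyadicBlock (F : Finset ℕ) (k : ℕ) : Finset ℕ := F.filter fun n => Nat.log 2 (n + 1) = k

theorem le_of_mem_dyadicBlock {F : Finset ℕ} {k n : ℕ} (h : n ∈ dyadicBlock F k) :
    2 ^ k ≤ n + 1 ∧ n + 1 < 2 ^ (k + 1) := by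
  obtain rfl := (Finset.mem_filter.mp h).2
  exact ⟨Nat.pow_log_le_self 2 (Nat.succ_ne_zero n), Nat.lt_pow_succ_log_self (by norm_num) _⟩

theorem card_dyadicBlock_le (F : Finset ℕ) (k : ℕ) : (dyadicBlock F k).card ≤ 2 ^ k := by
  have hsub : dyadicBlock F k ⊆ Finset.Ico (2 ^ k - 1) (2 ^ (k + 1) - 1) := fun n hn => by
    have h := le_of_mem_dyadicBlock hn
    rw [Finset.mem_Ico]
    omega
  refine (Finset.card_le_card hsub).trans ?_
  rw [Nat.card_Ico, pow_succ]
  have := Nat.one_le_two_pow (n := k)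
  omega

theorem sum_dyadicBlock (F : Finset ℕ) (g : ℕ → ℝ) :
    ∑ n ∈ F, g n = ∑ k ∈ Finset.range (F.sup (fun n => Nat.log 2 (n + 1)) + 1),
      ∑ n ∈ dyadicBlock F k, g n := by
  refine (Finset.sum_fiberwise_of_maps_to (fun n hn => ?_) g).symm
  rw [Finset.mem_range]
  exact Nat.lt_succ_of_le (Finset.le_sup (f := fun n => Nat.log 2 (n + 1)) hn)

/-- A dyadic block is bounded by its `ℓ²` norm times the square root of the Christoffel function. -/
theorem abs_sum_dyadicBlock_le {M σ : ℝ} (hM : 0 ≤ M) (hσ : 0 ≤ σ) (F : Finset ℕ) (c u : ℕ → ℝ)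
    (hu : ∀ n : ℕ, |u n| ≤ M * ((n : ℝ) + 1) ^ σ) (k : ℕ) :
    |∑ n ∈ dyadicBlock F k, c n * u n| ≤
      (M * 2 ^ σ) * (((2 : ℝ) ^ (σ + 1 / 2)) ^ k *
        Real.sqrt (∑ n ∈ dyadicBlock F k, c n ^ 2)) := by
  have hcs := Finset.sum_mul_sq_le_sq_mul_sq (dyadicBlock F k) c u
  have hsum : ∑ n ∈ dyadicBlock F k, u n ^ 2 ≤
      (M * 2 ^ σ * ((2 : ℝ) ^ (σ + 1 / 2)) ^ k) ^ 2 := by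
    have hone : ∀ n ∈ dyadicBlock F k, u n ^ 2 ≤ (M * 2 ^ σ * ((2 : ℝ) ^ σ) ^ k) ^ 2 := by
      intro n hn
      rw [← sq_abs (u n)]
      refine pow_le_pow_left₀ (abs_nonneg _) ((hu n).trans ?_) 2
      rw [mul_assoc]
      refine mul_le_mul_of_nonneg_left ?_ hM
      have h2 : (n : ℝ) + 1 ≤ 2 ^ (k + 1) := by exact_mod_cast (le_of_mem_dyadicBlock hn).2.le
      refine (Real.rpow_le_rpow (by positivity) h2 hσ).trans (le_of_eq ?_)
      rw [pow_succ', Real.mul_rpow (by norm_num) (by positivity), ← Real.rpow_natCast,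
        ← Real.rpow_natCast, ← Real.rpow_mul (by norm_num), ← Real.rpow_mul (by norm_num),
        mul_comm σ]
    refine (Finset.sum_le_card_nsmul _ _ _ hone).trans ?_
    rw [nsmul_eq_mul]
    have hcard : ((dyadicBlock F k).card : ℝ) ≤ 2 ^ k := by
      exact_mod_cast card_dyadicBlock_le F k
    refine (mul_le_mul_of_nonneg_right hcard (by positivity)).trans (le_of_eq ?_)
    have e : (((2 : ℝ) ^ (1 / 2 : ℝ)) ^ k) ^ 2 = 2 ^ k := by
      rw [← Real.sqrt_eq_rpow, ← pow_mul, mul_comm, pow_mul, Real.sq_sqrt (by norm_num)]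
    rw [Real.rpow_add (by norm_num), mul_pow ((2 : ℝ) ^ σ) _ k, ← mul_assoc,
      mul_pow _ (((2 : ℝ) ^ (1 / 2 : ℝ)) ^ k) 2, e]
    ring
  refine abs_le_of_sq_le_sq (hcs.trans ?_) (by positivity)
  rw [← mul_assoc, mul_pow _ _ 2, Real.sq_sqrt (Finset.sum_nonneg fun n _ => sq_nonneg _), mul_comm]
  exact mul_le_mul_of_nonneg_right hsum (Finset.sum_nonneg fun n _ => sq_nonneg _)

/-- The powers of `2` collected from the uniform bound of a block, `2^{k(σ+1/2)(p-2)}`, and from the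
passage from `ℓ²` to `ℓ^p` on a block, `2^{k(p-2)/2}`, combine to the weight `(n+1)^{(σ+1)(p-2)}`. -/
theorem dyadicBlock_rpow_le {p σ : ℝ} (hp : 2 ≤ p) (hσ : 0 ≤ σ) (F : Finset ℕ) (c : ℕ → ℝ)
    (k : ℕ) : ((((2 : ℝ) ^ (σ + 1 / 2)) ^ k) ^ (p - 2) *
        Real.sqrt (∑ n ∈ dyadicBlock F k, c n ^ 2) ^ p) ≤
      ∑ n ∈ dyadicBlock F k, |c n| ^ p * ((n : ℝ) + 1) ^ ((σ + 1) * (p - 2)) := by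
  have hnn : 0 ≤ ∑ n ∈ dyadicBlock F k, c n ^ 2 := Finset.sum_nonneg fun n _ => sq_nonneg _
  have h1 : Real.sqrt (∑ n ∈ dyadicBlock F k, c n ^ 2) ^ p ≤
      ((2 : ℝ) ^ k) ^ (p / 2 - 1) * ∑ n ∈ dyadicBlock F k, |c n| ^ p := by
    have h := Real.rpow_sum_le_const_mul_sum_rpow (dyadicBlock F k) (fun n => c n ^ 2)
      (p := p / 2) (by linarith)
    have e1 : ∀ n, |c n ^ 2| = c n ^ 2 := fun n => abs_of_nonneg (sq_nonneg _)
    have e2 : ∀ n, (c n ^ 2) ^ (p / 2) = |c n| ^ p := fun n => by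
      rw [← sq_abs, ← Real.rpow_natCast, ← Real.rpow_mul (abs_nonneg _)]
      congr 1
      push_cast
      ring
    simp only [e1, e2] at h
    rw [Real.sqrt_eq_rpow, ← Real.rpow_mul hnn]
    have e3 : 1 / 2 * p = p / 2 := by ring
    rw [e3]
    refine h.trans (mul_le_mul_of_nonneg_right ?_
      (Finset.sum_nonneg fun n _ => Real.rpow_nonneg (abs_nonneg _) _))
    exact Real.rpow_le_rpow (by positivity) (by exact_mod_cast card_dyadicBlock_le F k)
      (by linarith)
  have h2 : (((2 : ℝ) ^ (σ + 1 / 2)) ^ k) ^ (p - 2) * ((2 : ℝ) ^ k) ^ (p / 2 - 1) =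
      ((2 : ℝ) ^ k) ^ ((σ + 1) * (p - 2)) := by
    have h0 : (0 : ℝ) ≤ 2 := by norm_num
    rw [← Real.rpow_natCast, ← Real.rpow_natCast, ← Real.rpow_mul h0, ← Real.rpow_mul h0,
      ← Real.rpow_mul h0, ← Real.rpow_mul h0, ← Real.rpow_add (by norm_num)]
    congr 1
    ring
  refine (mul_le_mul_of_nonneg_left h1 (by positivity)).trans ?_
  rw [← mul_assoc, h2, Finset.mul_sum]
  refine Finset.sum_le_sum fun n hn => ?_
  rw [mul_comm]
  refine mul_le_mul_of_nonneg_left ?_ (Real.rpow_nonneg (abs_nonneg _) _)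
  have h3 : ((2 : ℝ) ^ k) ≤ (n : ℝ) + 1 := by exact_mod_cast (le_of_mem_dyadicBlock hn).1
  exact Real.rpow_le_rpow (by positivity) h3 (mul_nonneg (by linarith) (by linarith))

/-- The Paley inequality for an orthonormal system with `|e_n| ≤ M (n+1)^σ`. A dyadic block is
estimated both in `L₂`, by orthogonality, and uniformly; after expanding the `p`-th power of the
sum of the blocks, the two blocks of highest index are paired in `L₂` and all others are estimated
uniformly. -/
theorem exists_integral_abs_sum_rpow_le {α : Type*} [MeasurableSpace α] {μ : Measure α}
    [IsFiniteMeasure μ] {e : ℕ → α → ℝ} (he : ∀ n, AEStronglyMeasurable (e n) μ)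
    (horth : ∀ n m, ∫ x, e n x * e m x ∂μ = if n = m then 1 else 0) {M σ : ℝ} (hM : 0 ≤ M)
    (hσ : 0 ≤ σ) (hbound : ∀ᵐ x ∂μ, ∀ n : ℕ, |e n x| ≤ M * ((n : ℝ) + 1) ^ σ) {p : ℝ}
    (hp : 2 ≤ p) : ∃ C : ℝ, 0 ≤ C ∧ ∀ (F : Finset ℕ) (c : ℕ → ℝ),
      ∫ x, |∑ n ∈ F, c n * e n x| ^ p ∂μ ≤
        C * ∑ n ∈ F, |c n| ^ p * ((n : ℝ) + 1) ^ ((σ + 1) * (p - 2)) := by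
  have he2 : ∀ n, MemLp (e n) 2 μ := fun n =>
    MemLp.of_bound (he n) (M * ((n : ℝ) + 1) ^ σ) (hbound.mono fun x hx => hx n)
  rcases hp.eq_or_lt with rfl | hp2
  · refine ⟨1, zero_le_one, fun F c => ?_⟩
    simp only [sub_self, mul_zero, Real.rpow_zero, mul_one, one_mul]
    have h2 : ∀ y : ℝ, |y| ^ (2 : ℝ) = y ^ 2 := fun y => by
      rw [Real.rpow_ofNat, sq_abs]
    simp only [h2]
    exact (integral_sq_sum_orthonormal he2 horth F c).le
  have hD : (1 : ℝ) < 2 ^ (σ + 1 / 2) := Real.one_lt_rpow (by norm_num) (by linarith)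
  obtain ⟨C, hC, hseq⟩ := exists_double_sum_le hD hp2
  set D : ℝ := 2 ^ (σ + 1 / 2)
  set L : ℝ := M * 2 ^ σ
  have hL : 0 ≤ L := by positivity
  have hpp : 0 ≤ p * (p - 1) := mul_nonneg (by linarith) (by linarith)
  refine ⟨p * (p - 1) * L ^ (p - 2) * C, by positivity, fun F c => ?_⟩
  set Δ : ℕ → α → ℝ := fun k x => ∑ n ∈ dyadicBlock F k, c n * e n x
  set A : ℕ → ℝ := fun k => Real.sqrt (∑ n ∈ dyadicBlock F k, c n ^ 2)
  have hA : ∀ k, 0 ≤ A k := fun k => Real.sqrt_nonneg _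
  set K := F.sup (fun n => Nat.log 2 (n + 1)) + 1
  set H : ℕ → ℝ := fun j => ∑ i ∈ Finset.range (j + 1), D ^ i * A i
  have hH : ∀ j, 0 ≤ H j := fun j =>
    Finset.sum_nonneg fun i _ => mul_nonneg (by positivity) (hA i)
  have hΔ2 : ∀ k, MemLp (Δ k) 2 μ := fun k =>
    memLp_finsetSum _ fun n _ => (he2 n).const_mul _
  have hΔint : ∀ k j, Integrable (fun x => |Δ k x| * |Δ j x|) μ := fun k j =>
    (hΔ2 k).norm.integrable_mul (hΔ2 j).norm
  have hΔA : ∀ k j, ∫ x, |Δ k x| * |Δ j x| ∂μ ≤ A k * A j := by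
    intro k j
    refine (integral_abs_mul_abs_le (hΔ2 k) (hΔ2 j)).trans (le_of_eq ?_)
    simp only [Δ, A]
    rw [integral_sq_sum_orthonormal he2 horth, integral_sq_sum_orthonormal he2 horth]
  have hpt : ∀ᵐ x ∂μ, |∑ n ∈ F, c n * e n x| ^ p ≤ p * (p - 1) * L ^ (p - 2) *
      ∑ k ∈ Finset.range K, ∑ j ∈ Finset.range (k + 1),
        |Δ k x| * |Δ j x| * H j ^ (p - 2) := by
    filter_upwards [hbound] with x hx
    have h1 : |∑ n ∈ F, c n * e n x| ≤ ∑ k ∈ Finset.range K, |Δ k x| := by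
      rw [sum_dyadicBlock]
      exact Finset.abs_sum_le_sum_abs _ _
    refine (Real.rpow_le_rpow (abs_nonneg _) h1 (by linarith)).trans ?_
    refine (sum_range_rpow_le_double hp (fun k => abs_nonneg (Δ k x)) K).trans ?_
    rw [mul_assoc (p * (p - 1)), Finset.mul_sum (a := L ^ (p - 2))]
    refine mul_le_mul_of_nonneg_left (Finset.sum_le_sum fun k _ => ?_) hpp
    rw [Finset.mul_sum]
    refine Finset.sum_le_sum fun j _ => ?_
    have h2 : ∑ i ∈ Finset.range (j + 1), |Δ i x| ≤ L * H j := by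
      simp only [H]
      rw [Finset.mul_sum]
      exact Finset.sum_le_sum fun i _ =>
        abs_sum_dyadicBlock_le hM hσ F c (fun n => e n x) hx i
    have h3 : (∑ i ∈ Finset.range (j + 1), |Δ i x|) ^ (p - 2) ≤ L ^ (p - 2) * H j ^ (p - 2) := by
      rw [← Real.mul_rpow hL (hH j)]
      exact Real.rpow_le_rpow (Finset.sum_nonneg fun i _ => abs_nonneg _) h2 (by linarith)
    calc _ ≤ |Δ k x| * |Δ j x| * (L ^ (p - 2) * H j ^ (p - 2)) :=
          mul_le_mul_of_nonneg_left h3 (by positivity)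
      _ = _ := by ring
  have hRint : ∀ k, Integrable (fun x => ∑ j ∈ Finset.range (k + 1),
      |Δ k x| * |Δ j x| * H j ^ (p - 2)) μ := fun k =>
    integrable_finsetSum _ fun j _ => (hΔint k j).mul_const _
  calc ∫ x, |∑ n ∈ F, c n * e n x| ^ p ∂μ
      ≤ ∫ x, p * (p - 1) * L ^ (p - 2) * ∑ k ∈ Finset.range K, ∑ j ∈ Finset.range (k + 1),
        |Δ k x| * |Δ j x| * H j ^ (p - 2) ∂μ :=
        integral_mono_of_nonneg (.of_forall fun x => Real.rpow_nonneg (abs_nonneg _) _)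
          ((integrable_finsetSum _ fun k _ => hRint k).const_mul _) hpt
    _ = p * (p - 1) * L ^ (p - 2) * ∑ k ∈ Finset.range K, ∑ j ∈ Finset.range (k + 1),
        (∫ x, |Δ k x| * |Δ j x| ∂μ) * H j ^ (p - 2) := by
        rw [integral_const_mul, integral_finsetSum _ fun k _ => hRint k]
        congr 1
        refine Finset.sum_congr rfl fun k _ => ?_
        rw [integral_finsetSum _ fun j _ => (hΔint k j).mul_const _]
        exact Finset.sum_congr rfl fun j _ => integral_mul_const _ _
    _ ≤ p * (p - 1) * L ^ (p - 2) * ∑ k ∈ Finset.range K, ∑ j ∈ Finset.range (k + 1),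
        A k * A j * H j ^ (p - 2) := by
        refine mul_le_mul_of_nonneg_left (Finset.sum_le_sum fun k _ =>
          Finset.sum_le_sum fun j _ => ?_) (by positivity)
        exact mul_le_mul_of_nonneg_right (hΔA k j) (Real.rpow_nonneg (hH j) _)
    _ ≤ p * (p - 1) * L ^ (p - 2) * (C * ∑ k ∈ Finset.range K, (D ^ k) ^ (p - 2) * A k ^ p) :=
        mul_le_mul_of_nonneg_left (hseq A hA K) (by positivity)
    _ ≤ p * (p - 1) * L ^ (p - 2) * (C * ∑ k ∈ Finset.range K, ∑ n ∈ dyadicBlock F k,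
        |c n| ^ p * ((n : ℝ) + 1) ^ ((σ + 1) * (p - 2))) := by
        refine mul_le_mul_of_nonneg_left (mul_le_mul_of_nonneg_left
          (Finset.sum_le_sum fun k _ => ?_) hC) (by positivity)
        exact dyadicBlock_rpow_le hp hσ F c k
    _ = _ := by
        rw [← sum_dyadicBlock]
        ring

/-! ### The Sonin operators -/

/-- Functions on `(0, b-a)` and `(a,b)` are extended by zero, which turns `soninI` into a
convolution on the line. -/
theorem convolution_indicator_eq {κ g : ℝ → ℝ} {a b x : ℝ} (hx : x ≤ b) :
    convolution ((Ioo 0 (b - a)).indicator κ) ((Ioo a b).indicator g)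
      (ContinuousLinearMap.mul ℝ ℝ) volume x = ∫ t in Ioo a x, κ (x - t) * g t := by
  rw [convolution_def, ← integral_indicator measurableSet_Ioo,
    ← integral_sub_left_eq_self _ volume x]
  refine integral_congr_ae (.of_forall fun t => ?_)
  simp only [ContinuousLinearMap.mul_apply', sub_sub_cancel, indicator, mem_Ioo]
  by_cases h : a < t ∧ t < x
  · have h1 : a < t ∧ t < b := ⟨h.1, h.2.trans_le hx⟩
    have h2 : 0 < x - t ∧ x - t < b - a := ⟨by linarith [h.2], by linarith [h.1]⟩
    rw [if_pos h, if_pos h1, if_pos h2]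
  · rw [if_neg h]
    by_cases h1 : a < t ∧ t < b
    · rw [if_neg (fun h2 => h ⟨h1.1, by linarith [h2.1]⟩), zero_mul]
    · rw [if_neg h1, mul_zero]

theorem soninI_eq_setIntegral {κ g : ℝ → ℝ} {a x : ℝ} (hx : a ≤ x) :
    soninI κ a g x = ∫ t in Ioo a x, κ (x - t) * g t := by
  rw [soninI, intervalIntegral.integral_of_le hx, integral_Ioc_eq_integral_Ioo]

theorem soninI_eq_convolution {κ g : ℝ → ℝ} {a b x : ℝ} (hx : x ∈ Ioo a b) :
    soninI κ a g x = convolution ((Ioo 0 (b - a)).indicator κ) ((Ioo a b).indicator g)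
      (ContinuousLinearMap.mul ℝ ℝ) volume x := by
  rw [convolution_indicator_eq hx.2.le, soninI_eq_setIntegral hx.1.le]

theorem integrableOn_soninI {κ g : ℝ → ℝ} {a b : ℝ} (hκ : IntegrableOn κ (Ioo 0 (b - a)))
    (hg : IntegrableOn g (Ioo a b)) : IntegrableOn (soninI κ a g) (Ioo a b) := by
  have h := (Integrable.integrable_convolution (ContinuousLinearMap.mul ℝ ℝ)
    (hκ.integrable_indicator measurableSet_Ioo) (hg.integrable_indicator measurableSet_Ioo))
  exact h.integrableOn.congr_fun (fun x hx => (soninI_eq_convolution hx).symm) measurableSet_Ioo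

theorem SoninCondition.symm {a b : ℝ} {ϱ ϑ : ℝ → ℝ} (h : SoninCondition a b ϱ ϑ) :
    SoninCondition a b ϑ ϱ := by
  filter_upwards [h] with x hx
  rw [← hx]
  have := intervalIntegral.integral_comp_sub_left (fun t => ϱ (x - t) * ϑ t) (a := 0) (b := x) x
  simp only [sub_zero, sub_self, sub_sub_cancel] at this
  rw [← this]
  simp only [mul_comm]

theorem convolution_assoc_ae {f g k : ℝ → ℝ} (hf : Integrable f) (hg : Integrable g)
    (hk : Integrable k) : ∀ᵐ x, convolution (convolution f g (ContinuousLinearMap.mul ℝ ℝ) volume)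
      k (ContinuousLinearMap.mul ℝ ℝ) volume x =
      convolution f (convolution g k (ContinuousLinearMap.mul ℝ ℝ) volume)
        (ContinuousLinearMap.mul ℝ ℝ) volume x := by
  have h1 := Integrable.integrable_convolution (ContinuousLinearMap.mul ℝ ℝ) hg.norm hk.norm
  filter_upwards [hf.norm.ae_convolution_exists (ContinuousLinearMap.mul ℝ ℝ) h1] with x hx
  exact convolution_assoc _ _ _ _ (fun x y z => mul_assoc x y z) hf.1 hg.1 hk.1
    (hf.ae_convolution_exists _ hg) (hg.norm.ae_convolution_exists _ hk.norm) hx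

/-- Under the Sonin condition `I^ϱ I^ϑ` is integration from `a`. -/
theorem soninI_soninI {a b : ℝ} {ϱ ϑ g : ℝ → ℝ} (hϱ : IntegrableOn ϱ (Ioo 0 (b - a)))
    (hϑ : IntegrableOn ϑ (Ioo 0 (b - a))) (h : SoninCondition a b ϱ ϑ)
    (hg : IntegrableOn g (Ioo a b)) :
    ∀ᵐ x ∂(volume.restrict (Ioo a b)), soninI ϱ a (soninI ϑ a g) x = ∫ t in a..x, g t := by
  have hassoc := ae_restrict_of_ae (s := Ioo a b)
    (convolution_assoc_ae (hϱ.integrable_indicator measurableSet_Ioo)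
    (hϑ.integrable_indicator measurableSet_Ioo) (hg.integrable_indicator measurableSet_Ioo))
  filter_upwards [hassoc, ae_restrict_mem measurableSet_Ioo] with x hx hxI
  have e1 : soninI ϱ a (soninI ϑ a g) x = convolution ((Ioo 0 (b - a)).indicator ϱ)
      (convolution ((Ioo 0 (b - a)).indicator ϑ) ((Ioo a b).indicator g)
        (ContinuousLinearMap.mul ℝ ℝ) volume) (ContinuousLinearMap.mul ℝ ℝ) volume x := by
    rw [soninI_eq_convolution hxI, convolution_def, convolution_def]
    refine integral_congr_ae (.of_forall fun t => ?_)
    simp only [ContinuousLinearMap.mul_apply']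
    by_cases h1 : x - t ∈ Ioo a b
    · rw [indicator_of_mem h1, soninI_eq_convolution h1]
    · rw [indicator_of_notMem h1, mul_zero]
      rcases le_or_gt (x - t) a with h2 | h2
      · have hba : a < b := hxI.1.trans hxI.2
        rw [convolution_indicator_eq (h2.trans hba.le), Ioo_eq_empty (not_lt.mpr h2)]
        simp
      · have h3 : b ≤ x - t := not_lt.mp fun h3 => h1 ⟨h2, h3⟩
        rw [indicator_of_notMem, zero_mul]
        intro h4
        linarith [h4.1, hxI.2]
  rw [e1, ← hx, convolution_def, ← integral_sub_left_eq_self _ volume x,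
    intervalIntegral.integral_of_le hxI.1.le, integral_Ioc_eq_integral_Ioo,
    ← integral_indicator measurableSet_Ioo]
  have hone : ∀ᵐ t, x - t ∈ Ioo 0 (b - a) → ∫ s in (0 : ℝ)..(x - t), ϱ (x - t - s) * ϑ s = 1 :=
    (quasiMeasurePreserving_sub_left_of_right_invariant volume x).ae
      ((ae_restrict_iff' measurableSet_Ioo).mp h)
  refine integral_congr_ae ?_
  filter_upwards [hone] with t ht
  simp only [ContinuousLinearMap.mul_apply', sub_sub_cancel]
  by_cases h1 : t ∈ Ioo a b
  · rw [indicator_of_mem h1]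
    have e2 := convolution_indicator_eq (κ := ϱ) (g := ϑ) (a := 0) (b := b - a) (x := x - t)
      (by linarith [h1.1, hxI.2])
    simp only [sub_zero] at e2
    rw [e2]
    by_cases h2 : t < x
    · have h3 : x - t ∈ Ioo 0 (b - a) := ⟨by linarith, by linarith [h1.1, hxI.2]⟩
      have h4 := ht h3
      rw [intervalIntegral.integral_of_le h3.1.le, integral_Ioc_eq_integral_Ioo] at h4
      rw [h4, one_mul, indicator_of_mem (show t ∈ Ioo a x from ⟨h1.1, h2⟩)]
    · rw [Ioo_eq_empty (fun h3 => h2 (by linarith)), indicator_of_notMem (fun h3 => h2 h3.2)]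
      simp
  · rw [indicator_of_notMem h1, mul_zero,
      indicator_of_notMem (fun h3 => h1 ⟨h3.1, h3.2.trans hxI.2⟩)]

theorem soninI_congr {a b : ℝ} {κ g g' : ℝ → ℝ}
    (h : g =ᵐ[volume.restrict (Ioo a b)] g') {x : ℝ} (hx : x ∈ Ioo a b) :
    soninI κ a g x = soninI κ a g' x := by
  rw [soninI_eq_setIntegral hx.1.le, soninI_eq_setIntegral hx.1.le]
  have h' := ae_restrict_of_ae_restrict_of_subset (Ioo_subset_Ioo_right hx.2.le) h
  refine integral_congr_ae ?_
  filter_upwards [h'] with t ht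
  rw [ht]

/-- An integrable function on `(a,b)` is determined by its primitive. -/
theorem ae_eq_of_primitive_ae_eq {a b : ℝ} {g g' : ℝ → ℝ} (hg : IntegrableOn g (Ioo a b))
    (hg' : IntegrableOn g' (Ioo a b))
    (h : ∀ᵐ x ∂(volume.restrict (Ioo a b)), ∫ t in a..x, g t = ∫ t in a..x, g' t) :
    g =ᵐ[volume.restrict (Ioo a b)] g' := by
  rcases le_or_gt b a with hab | hab
  · simp [Ioo_eq_empty (not_lt.mpr hab), EventuallyEq]
  set D : ℝ → ℝ := (Ioo a b).indicator fun x => g x - g' x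
  have hD : Integrable D := (hg.sub hg').integrable_indicator measurableSet_Ioo
  have hprim : ∀ x ∈ Ioo a b, ∫ t in a..x, D t = (∫ t in a..x, g t) - ∫ t in a..x, g' t := by
    intro x hx
    have i1 : IntervalIntegrable g volume a x := by
      rw [intervalIntegrable_iff_integrableOn_Ioo_of_le hx.1.le]
      exact hg.mono_set (Ioo_subset_Ioo_right hx.2.le)
    have i2 : IntervalIntegrable g' volume a x := by
      rw [intervalIntegrable_iff_integrableOn_Ioo_of_le hx.1.le]
      exact hg'.mono_set (Ioo_subset_Ioo_right hx.2.le)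
    rw [← intervalIntegral.integral_sub i1 i2, intervalIntegral.integral_of_le hx.1.le,
      intervalIntegral.integral_of_le hx.1.le, integral_Ioc_eq_integral_Ioo,
      integral_Ioc_eq_integral_Ioo]
    exact setIntegral_congr_fun measurableSet_Ioo fun t ht =>
      indicator_of_mem (show t ∈ Ioo a b from ⟨ht.1, ht.2.trans hx.2⟩) _
  have hzero : ∀ x ∈ Ioo a b, ∫ t in a..x, D t = 0 := by
    have hc : Continuous fun x => ∫ t in a..x, D t :=
      intervalIntegral.continuous_primitive (fun _ _ => hD.intervalIntegrable) a
    have hae : (fun x => ∫ t in a..x, D t) =ᵐ[volume.restrict (Ioo a b)] fun _ => 0 := by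
      filter_upwards [h, ae_restrict_mem measurableSet_Ioo] with x hx hxI
      rw [hprim x hxI, hx, sub_self]
    exact Measure.eqOn_open_of_ae_eq hae isOpen_Ioo hc.continuousOn continuousOn_const
  have hderiv := LocallyIntegrable.ae_hasDerivAt_integral hD.locallyIntegrable
  filter_upwards [ae_restrict_of_ae hderiv, ae_restrict_mem measurableSet_Ioo] with x hx hxI
  have h1 := hx a
  have h2 : HasDerivAt (fun x => ∫ t in a..x, D t) 0 x :=
    (hasDerivAt_const x (0 : ℝ)).congr_of_eventuallyEq
      ((isOpen_Ioo.eventually_mem hxI).mono fun y hy => hzero y hy)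
  have h3 := h1.unique h2
  simp only [D, indicator_of_mem hxI] at h3
  linarith

/-- The Abel–Sonin equation `I^ϱ φ = f` is equivalent to `I^ϑ f` being the primitive of `φ`. -/
theorem solvesAbelSonin_iff {a b : ℝ} {ϱ ϑ φ f : ℝ → ℝ}
    (hϱ : IntegrableOn ϱ (Ioo 0 (b - a))) (hϑ : IntegrableOn ϑ (Ioo 0 (b - a)))
    (h : SoninCondition a b ϱ ϑ) (hφ : IntegrableOn φ (Ioo a b)) (hf : IntegrableOn f (Ioo a b)) :
    SolvesAbelSonin a b ϱ φ f ↔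
      ∀ᵐ x ∂(volume.restrict (Ioo a b)), soninI ϑ a f x = ∫ t in a..x, φ t := by
  constructor
  · intro hs
    filter_upwards [soninI_soninI hϑ hϱ h.symm hφ, ae_restrict_mem measurableSet_Ioo] with x hx hxI
    rw [← hx]
    exact (soninI_congr hs hxI).symm
  · intro hs
    refine ae_eq_of_primitive_ae_eq (integrableOn_soninI hϱ hφ) hf ?_
    have e1 := soninI_soninI hϱ hϑ h hf
    have e2 := soninI_soninI hϱ hϑ h (integrableOn_soninI hϱ hφ)
    filter_upwards [e1, e2, soninI_soninI hϑ hϱ h.symm hφ, ae_restrict_mem measurableSet_Ioo]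
      with x h1 h2 h3 hxI
    rw [← h1, ← h2]
    refine soninI_congr ?_ hxI
    filter_upwards [hs, soninI_soninI hϑ hϱ h.symm hφ] with t ht ht'
    rw [ht, ht']

/-! ### Uniqueness of Jacobi expansions -/

/-- An integrable function all of whose integrals against Jacobi polynomials vanish is zero. -/
theorem ae_eq_zero_of_integral_mul_jacobiP {a b β γ : ℝ} (hab : a < b) (hβ : -1 < β)
    (hγ : -1 < γ) {g : ℝ → ℝ} (hg : IntegrableOn g (Ioo a b))
    (h : ∀ n, ∫ x in Ioo a b, g x * jacobiP a b β γ n x = 0) :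
    ∀ᵐ x ∂(volume.restrict (Ioo a b)), g x = 0 := by
  have hmul : ∀ u : ℝ → ℝ, Continuous u → IntegrableOn (fun x => g x * u x) (Ioo a b) := by
    intro u hu
    obtain ⟨C, hC⟩ := (isCompact_Icc (a := a) (b := b)).exists_bound_of_continuousOn
      hu.continuousOn
    refine Integrable.mul_bdd hg hu.aestronglyMeasurable (c := C) ?_
    filter_upwards [ae_restrict_mem measurableSet_Ioo] with x hx
    exact hC x (Ioo_subset_Icc_self hx)
  have hpoly : ∀ q : Polynomial ℝ, ∫ x in Ioo a b, g x * q.eval x = 0 := by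
    intro q
    obtain ⟨c, hc⟩ := exists_eq_sum_jacobiP hab q.natDegree hβ hγ q le_rfl
    simp only [hc, Finset.mul_sum, mul_left_comm (g _)]
    rw [integral_finsetSum _ fun k _ => (hmul _ (continuous_jacobiP a b β γ k)).const_mul _]
    simp [integral_const_mul, h]
  have hcont : ∀ u : ℝ → ℝ, Continuous u → ∫ x in Ioo a b, g x * u x = 0 := by
    intro u hu
    have hle : ∀ ε > 0, |∫ x in Ioo a b, g x * u x| ≤ ε * ∫ x in Ioo a b, |g x| := by
      intro ε hε
      obtain ⟨q, hq⟩ := exists_polynomial_near_of_continuousOn a b u hu.continuousOn ε hε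
      have e : ∫ x in Ioo a b, g x * u x = ∫ x in Ioo a b, g x * (u x - q.eval x) := by
        simp only [mul_sub]
        rw [integral_sub (hmul u hu) (hmul _ q.continuous), hpoly, sub_zero]
      rw [e, ← integral_const_mul]
      rw [← Real.norm_eq_abs]
      refine norm_integral_le_of_norm_le (hg.abs.const_mul ε) ?_
      filter_upwards [ae_restrict_mem measurableSet_Ioo] with x hx
      rw [norm_mul, Real.norm_eq_abs, Real.norm_eq_abs, mul_comm, abs_sub_comm]
      exact mul_le_mul_of_nonneg_right (hq x (Ioo_subset_Icc_self hx)).le (abs_nonneg _)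
    by_contra hne
    have hpos : 0 < |∫ x in Ioo a b, g x * u x| := abs_pos.mpr hne
    have hnn : 0 ≤ ∫ x in Ioo a b, |g x| := integral_nonneg fun x => abs_nonneg _
    set I := |∫ x in Ioo a b, g x * u x|
    set J := ∫ x in Ioo a b, |g x|
    have h1 := hle (I / (2 * (J + 1))) (by positivity)
    have h2 : I / (2 * (J + 1)) * J = I * (J / (2 * (J + 1))) := by ring
    have h3 : J / (2 * (J + 1)) < 1 := by
      rw [div_lt_one (by positivity)]; linarith
    rw [h2] at h1
    nlinarith
  refine ae_eq_zero_of_integral_contDiff_smul_eq_zero hg.locallyIntegrable fun u hu _ => ?_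
  rw [← hcont u hu.continuous]
  simp only [smul_eq_mul, mul_comm]

/-! ### Jacobi coefficients of a primitive -/

theorem jacobiCoeff_congr {a b β γ : ℝ} {f g : ℝ → ℝ}
    (h : f =ᵐ[volume.restrict (Ioo a b)] g) (n : ℕ) :
    jacobiCoeff a b β γ f n = jacobiCoeff a b β γ g n := by
  refine integral_congr_ae ?_
  filter_upwards [ae_jacobiMeasure_iff.mpr h] with x hx
  rw [hx]

theorem jacobiCoeff_sum {a b β γ : ℝ} (hab : a < b) (hβ : -1 < β) (hγ : -1 < γ) (d : ℕ → ℝ)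
    {K j : ℕ} (hj : j < K) :
    jacobiCoeff a b β γ (fun x => ∑ k ∈ Finset.range K, d k * jacobiP a b β γ k x) j = d j := by
  unfold jacobiCoeff
  simp only [Finset.sum_mul, mul_assoc]
  have hint : ∀ k, Integrable (fun x => jacobiP a b β γ k x * jacobiP a b β γ j x)
      (jacobiMeasure a b β γ) := fun k => integrable_jacobiMeasure_of_continuous hab hβ hγ
    ((continuous_jacobiP a b β γ k).mul (continuous_jacobiP a b β γ j))
  rw [integral_finsetSum _ fun k _ => (hint k).const_mul _]
  simp only [integral_const_mul, integral_jacobiP_mul_jacobiP hab _ _ hβ hγ, mul_ite, mul_one,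
    mul_zero]
  rw [Finset.sum_ite_eq' _ j, if_pos (Finset.mem_range.mpr hj)]

theorem abs_primitive_le {a b : ℝ} {g : ℝ → ℝ} (hg : IntegrableOn g (Ioo a b)) {x : ℝ}
    (hx : x ∈ Ioo a b) : |∫ t in a..x, g t| ≤ ∫ t in Ioo a b, |g t| := by
  rw [intervalIntegral.integral_of_le hx.1.le, integral_Ioc_eq_integral_Ioo]
  refine (abs_integral_le_integral_abs (f := g)).trans ?_
  exact setIntegral_mono_set hg.abs (.of_forall fun x => abs_nonneg _)
    (Ioo_subset_Ioo_right hx.2.le).eventuallyLE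

theorem intervalIntegrable_of_mem_Ioo {a b : ℝ} {g : ℝ → ℝ} (hg : IntegrableOn g (Ioo a b)) {x : ℝ}
    (hx : x ∈ Ioo a b) : IntervalIntegrable g volume a x := by
  rw [intervalIntegrable_iff_integrableOn_Ioo_of_le hx.1.le]
  exact hg.mono_set (Ioo_subset_Ioo_right hx.2.le)

theorem integrable_primitive {a b β γ : ℝ} (hab : a < b) (hβ : -1 < β) (hγ : -1 < γ) {g : ℝ → ℝ}
    (hg : IntegrableOn g (Ioo a b)) :
    Integrable (fun x => ∫ t in a..x, g t) (jacobiMeasure a b β γ) := by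
  have hc : ContinuousOn (fun x => ∫ t in a..x, g t) (Ioo a b) := by
    refine (intervalIntegral.continuousOn_primitive_interval (b := b) ?_).mono ?_
    · rwa [uIcc_of_le hab.le, integrableOn_Icc_iff_integrableOn_Ioo]
    · rw [uIcc_of_le hab.le]; exact Ioo_subset_Icc_self
  exact integrable_jacobiMeasure_of_bounded hab hβ hγ
    (hc.aestronglyMeasurable measurableSet_Ioo) fun x hx => abs_primitive_le hg hx

theorem tendsto_jacobiCoeff_of_uniform {a b β γ : ℝ} (hab : a < b) (hβ : -1 < β) (hγ : -1 < γ)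
    {u : ℕ → ℝ → ℝ} {v : ℝ → ℝ} (hu : ∀ N, Integrable (u N) (jacobiMeasure a b β γ))
    (hv : Integrable v (jacobiMeasure a b β γ)) {ε : ℕ → ℝ} (hε : Tendsto ε atTop (𝓝 0))
    (h : ∀ N, ∀ x ∈ Ioo a b, |u N x - v x| ≤ ε N) (k : ℕ) :
    Tendsto (fun N => jacobiCoeff a b β γ (u N) k) atTop (𝓝 (jacobiCoeff a b β γ v k)) := by
  obtain ⟨C, hC⟩ := (isCompact_Icc (a := a) (b := b)).exists_bound_of_continuousOn
    (continuous_jacobiP a b β γ k).continuousOn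
  have hp : Integrable (jacobiP a b β γ k) (jacobiMeasure a b β γ) :=
    integrable_jacobiMeasure_of_continuous hab hβ hγ (continuous_jacobiP a b β γ k)
  have hmul : ∀ w : ℝ → ℝ, Integrable w (jacobiMeasure a b β γ) →
      Integrable (fun x => w x * jacobiP a b β γ k x) (jacobiMeasure a b β γ) := fun w hw =>
    Integrable.mul_bdd hw (continuous_jacobiP a b β γ k).aestronglyMeasurable (c := C)
      ((ae_mem_jacobiMeasure a b β γ).mono fun x hx => hC x (Ioo_subset_Icc_self hx))
  rw [tendsto_iff_dist_tendsto_zero]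
  have h0 : Tendsto (fun N => ε N * ∫ x, |jacobiP a b β γ k x| ∂(jacobiMeasure a b β γ)) atTop
      (𝓝 0) := by simpa using hε.mul_const _
  refine squeeze_zero (fun N => dist_nonneg) (fun N => ?_) h0
  rw [dist_eq_norm]
  unfold jacobiCoeff
  rw [← integral_sub (hmul _ (hu N)) (hmul _ hv), ← integral_const_mul]
  refine norm_integral_le_of_norm_le (hp.abs.const_mul _) ?_
  filter_upwards [ae_mem_jacobiMeasure a b β γ] with x hx
  rw [← sub_mul, norm_mul, Real.norm_eq_abs, Real.norm_eq_abs]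
  exact mul_le_mul_of_nonneg_right (h N x hx) (abs_nonneg _)

/-- If `∑ c_m p_m^{β,γ}` converges to `φ` in `L₁(a,b)`, its termwise primitive converges uniformly to
the primitive of `φ`. Comparing coefficients for the parameters `(β-1,γ-1)` gives those of the
primitive, and the coefficient of index zero shows that the expansion of the primitive converges
to zero at `a`. -/
theorem jacobiCoeff_primitive {a b β γ : ℝ} (hab : a < b) (hβ : 0 < β) (hγ : 0 < γ) {c : ℕ → ℝ}
    {φ : ℝ → ℝ} (hφ : IntegrableOn φ (Ioo a b))
    (hT : Tendsto (fun N : ℕ => ∫ x in Ioo a b,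
      |∑ m ∈ Finset.range N, c m * jacobiP a b β γ m x - φ x|) atTop (𝓝 0)) :
    (∀ m, jacobiCoeff a b (β - 1) (γ - 1) (fun x => ∫ t in a..x, φ t) (m + 1) =
      c m / jacobiS β γ m) ∧
    Tendsto (fun N : ℕ => ∑ m ∈ Finset.range N,
      jacobiCoeff a b (β - 1) (γ - 1) (fun x => ∫ t in a..x, φ t) m *
        jacobiP a b (β - 1) (γ - 1) m a) atTop (𝓝 0) := by
  have hβ' : -1 < β - 1 := by linarith
  have hγ' : -1 < γ - 1 := by linarith
  set p := jacobiP a b (β - 1) (γ - 1)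
  set Φ : ℝ → ℝ := fun x => ∫ t in a..x, φ t
  set T : ℕ → ℝ → ℝ := fun N x => ∑ m ∈ Finset.range N, c m * jacobiP a b β γ m x
  set S : ℕ → ℝ → ℝ := fun N x => ∑ m ∈ Finset.range N, c m / jacobiS β γ m * p (m + 1) x
  have hp0 : p 0 a ≠ 0 := (jacobiP_zero_pos hab hβ' hγ' a).ne'
  have hTc : ∀ N, Continuous (T N) := fun N =>
    continuous_finsetSum _ fun m _ => continuous_const.mul (continuous_jacobiP a b β γ m)
  have hS : ∀ N x, HasDerivAt (S N) (T N x) x := by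
    intro N x
    refine HasDerivAt.fun_sum fun m _ => ?_
    refine ((hasDerivAt_jacobiP_succ hab hβ hγ m x).const_mul _).congr_deriv ?_
    have := (jacobiS_pos (show 0 < β + γ by linarith) m).ne'
    field_simp
  have hFTC : ∀ N x, S N x - S N a = ∫ t in a..x, T N t := fun N x =>
    (intervalIntegral.integral_eq_sub_of_hasDerivAt (fun t _ => hS N t)
      ((hTc N).intervalIntegrable _ _)).symm
  -- the constant `S N a` is absorbed in the term of index zero
  set d : ℕ → ℕ → ℝ := fun N k => if k = 0 then -(S N a) / p 0 a else
    c (k - 1) / jacobiS β γ (k - 1)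
  have hd : ∀ N, (fun x => ∑ k ∈ Finset.range (N + 1), d N k * p k x) =
      fun x => S N x - S N a := by
    intro N
    ext x
    rw [Finset.sum_range_succ']
    simp only [d, if_true, Nat.succ_ne_zero, if_false, Nat.add_sub_cancel]
    rw [show p 0 x = p 0 a from jacobiP_zero_eq _ _ _ _ _ _, div_mul_cancel₀ _ hp0]
    simp only [S]
    ring
  have hconv : ∀ k, Tendsto (fun N => jacobiCoeff a b (β - 1) (γ - 1)
      (fun x => S N x - S N a) k) atTop (𝓝 (jacobiCoeff a b (β - 1) (γ - 1) Φ k)) := by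
    refine tendsto_jacobiCoeff_of_uniform hab hβ' hγ' (fun N => ?_)
      (integrable_primitive hab hβ' hγ' hφ) hT fun N x hx => ?_
    · refine integrable_jacobiMeasure_of_continuous hab hβ' hγ' ?_
      rw [← hd]
      exact continuous_finsetSum _ fun k _ => continuous_const.mul (continuous_jacobiP _ _ _ _ k)
    · have hTi : IntegrableOn (T N) (Ioo a b) :=
        ((hTc N).integrableOn_Icc).mono_set Ioo_subset_Icc_self
      rw [hFTC, ← intervalIntegral.integral_sub ((hTc N).intervalIntegrable _ _)
        (intervalIntegrable_of_mem_Ioo hφ hx)]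
      exact abs_primitive_le (hTi.sub hφ) hx
  have hco : ∀ m, jacobiCoeff a b (β - 1) (γ - 1) Φ (m + 1) = c m / jacobiS β γ m := by
    intro m
    refine tendsto_nhds_unique (hconv (m + 1)) ?_
    refine tendsto_const_nhds.congr' ?_
    filter_upwards [eventually_gt_atTop m] with N hN
    rw [← hd, jacobiCoeff_sum hab hβ' hγ' (d N) (show m + 1 < N + 1 by omega)]
    simp [d]
  refine ⟨hco, ?_⟩
  rw [← tendsto_add_atTop_iff_nat 1]
  have h0 := (hconv 0).mul_const (p 0 a)
  have h1 : ∀ N, jacobiCoeff a b (β - 1) (γ - 1) (fun x => S N x - S N a) 0 * p 0 a = -S N a := by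
    intro N
    rw [← hd, jacobiCoeff_sum hab hβ' hγ' (d N) (Nat.succ_pos N)]
    simp [d, hp0]
  simp only [h1] at h0
  have h2 := h0.neg.add (tendsto_const_nhds (x := jacobiCoeff a b (β - 1) (γ - 1) Φ 0 * p 0 a))
  simp only [neg_neg, neg_add_cancel] at h2
  refine h2.congr fun N => ?_
  rw [Finset.sum_range_succ']
  simp only [hco, S]

/-! ### The spaces `L_p(I,β,γ)` -/

theorem ofReal_two_le {p : ℝ} (hp : 2 ≤ p) : (2 : ENNReal) ≤ ENNReal.ofReal p := by
  rw [← ENNReal.ofReal_ofNat]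
  exact ENNReal.ofReal_le_ofReal hp

/-- For `β, γ < 1` and `p ≥ 2` the space `L_p(I,β,γ)` embeds into `L₁(I)`, since the reciprocal
weight `ω^{-β,-γ}` is integrable. -/
theorem exists_eLpNorm_one_le {a b β γ : ℝ} (hab : a < b) (hβ₀ : 0 < β) (hβ₁ : β < 1)
    (hγ₀ : 0 < γ) (hγ₁ : γ < 1) {q : ENNReal} (hq : 2 ≤ q) : ∃ C : ENNReal, C ≠ ⊤ ∧ ∀ g : ℝ → ℝ,
      AEStronglyMeasurable g (jacobiMeasure a b β γ) →
      eLpNorm g 1 (volume.restrict (Ioo a b)) ≤ C * eLpNorm g q (jacobiMeasure a b β γ) := by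
  have := isFiniteMeasure_jacobiMeasure (β := β) (γ := γ) hab (by linarith) (by linarith)
  have := isFiniteMeasure_jacobiMeasure (β := -β) (γ := -γ) hab (by linarith) (by linarith)
  set w : ℝ → ℝ := fun x => (jacobiWeight a b β γ x)⁻¹
  have hwm : AEStronglyMeasurable w (jacobiMeasure a b β γ) :=
    (measurable_jacobiWeight a b β γ).inv.aestronglyMeasurable
  have hw : MemLp w 2 (jacobiMeasure a b β γ) := by
    rw [memLp_two_iff_integrable_sq hwm, integrable_jacobiMeasure_iff]
    have h1 := integrable_jacobiMeasure_iff.mp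
      (integrable_const (μ := jacobiMeasure a b (-β) (-γ)) (1 : ℝ))
    refine h1.congr_fun (fun x hx => ?_) measurableSet_Ioo
    have hpos := jacobiWeight_pos (β := β) (γ := γ) hx
    have e : jacobiWeight a b (-β) (-γ) x = (jacobiWeight a b β γ x)⁻¹ := by
      unfold jacobiWeight
      rw [Real.rpow_neg (sub_pos.mpr hx.1).le, Real.rpow_neg (sub_pos.mpr hx.2).le, mul_inv]
    simp only [w, e]
    field_simp
  refine ⟨eLpNorm w 2 (jacobiMeasure a b β γ) *
    jacobiMeasure a b β γ univ ^ (1 / (2 : ENNReal).toReal - 1 / q.toReal), ?_, fun g hg => ?_⟩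
  · refine ENNReal.mul_ne_top hw.2.ne (ENNReal.rpow_ne_top_of_nonneg ?_ (measure_ne_top _ _))
    rcases eq_or_ne q ⊤ with rfl | hqt
    · simp
    · rw [sub_nonneg]
      exact one_div_le_one_div_of_le (by norm_num) (ENNReal.toReal_mono hqt hq)
  · have h1 : eLpNorm g 1 (volume.restrict (Ioo a b)) =
        eLpNorm (w • g) 1 (jacobiMeasure a b β γ) := by
      rw [eLpNorm_one_eq_lintegral_enorm, eLpNorm_one_eq_lintegral_enorm, lintegral_jacobiMeasure]
      refine setLIntegral_congr_fun measurableSet_Ioo fun x hx => ?_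
      have hpos := jacobiWeight_pos (β := β) (γ := γ) hx
      simp only [Pi.smul_apply', smul_eq_mul, enorm_mul, w]
      rw [← mul_assoc, ← Real.enorm_eq_ofReal hpos.le, ← enorm_mul, mul_inv_cancel₀ hpos.ne']
      simp
    rw [h1]
    refine (eLpNorm_smul_le_mul_eLpNorm (p := 2) (q := 2) (r := 1) hg hwm).trans ?_
    rw [mul_assoc]
    refine mul_le_mul_right ?_ _
    rw [mul_comm]
    exact eLpNorm_le_eLpNorm_mul_rpow_measure_univ hq hg

theorem integrableOn_of_memLp {a b β γ : ℝ} (hab : a < b) (hβ₀ : 0 < β) (hβ₁ : β < 1)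
    (hγ₀ : 0 < γ) (hγ₁ : γ < 1) {q : ENNReal} (hq : 2 ≤ q) {g : ℝ → ℝ}
    (hg : MemLp g q (jacobiMeasure a b β γ)) : IntegrableOn g (Ioo a b) := by
  obtain ⟨C, hC, h⟩ := exists_eLpNorm_one_le hab hβ₀ hβ₁ hγ₀ hγ₁ hq
  rw [IntegrableOn, ← memLp_one_iff_integrable]
  exact ⟨aestronglyMeasurable_jacobiMeasure_iff.mp hg.1,
    (h g hg.1).trans_lt (ENNReal.mul_lt_top hC.lt_top hg.2)⟩

theorem memLp_jacobiP {a b β γ : ℝ} (hab : a < b) (hβ : -1 < β) (hγ : -1 < γ) (n : ℕ)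
    (q : ENNReal) : MemLp (jacobiP a b β γ n) q (jacobiMeasure a b β γ) := by
  have := isFiniteMeasure_jacobiMeasure hab hβ hγ
  obtain ⟨C, hC⟩ := (isCompact_Icc (a := a) (b := b)).exists_bound_of_continuousOn
    (continuous_jacobiP a b β γ n).continuousOn
  exact MemLp.of_bound (continuous_jacobiP a b β γ n).aestronglyMeasurable C
    ((ae_mem_jacobiMeasure a b β γ).mono fun x hx => hC x (Ioo_subset_Icc_self hx))

theorem memLp_sum_jacobiP {a b β γ : ℝ} (hab : a < b) (hβ : -1 < β) (hγ : -1 < γ) (F : Finset ℕ)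
    (c : ℕ → ℝ) (q : ENNReal) :
    MemLp (fun x => ∑ m ∈ F, c m * jacobiP a b β γ m x) q (jacobiMeasure a b β γ) :=
  memLp_finsetSum _ fun n _ => (memLp_jacobiP hab hβ hγ n q).const_mul _

/-- Convergence in `L_p(I,β,γ)` implies convergence in `L₁(I)`. -/
theorem tendsto_integral_abs_of_tendsto_eLpNorm {a b β γ : ℝ} (hab : a < b) (hβ₀ : 0 < β)
    (hβ₁ : β < 1) (hγ₀ : 0 < γ) (hγ₁ : γ < 1) {q : ENNReal} (hq : 2 ≤ q) {u : ℕ → ℝ → ℝ}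
    {φ : ℝ → ℝ} (hu : ∀ N, MemLp (u N) q (jacobiMeasure a b β γ))
    (hφ : MemLp φ q (jacobiMeasure a b β γ))
    (h : Tendsto (fun N => eLpNorm (fun x => φ x - u N x) q (jacobiMeasure a b β γ)) atTop (𝓝 0)) :
    Tendsto (fun N => ∫ x in Ioo a b, |u N x - φ x|) atTop (𝓝 0) := by
  obtain ⟨C, hC, hle⟩ := exists_eLpNorm_one_le hab hβ₀ hβ₁ hγ₀ hγ₁ hq
  have h0 : Tendsto (fun N => eLpNorm (fun x => φ x - u N x) 1 (volume.restrict (Ioo a b))) atTop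
      (𝓝 0) := by
    refine tendsto_of_tendsto_of_tendsto_of_le_of_le tendsto_const_nhds
      (h := fun N => C * eLpNorm (fun x => φ x - u N x) q (jacobiMeasure a b β γ)) ?_
      (fun N => zero_le) (fun N => hle _ (hφ.sub (hu N)).1)
    simpa using ENNReal.Tendsto.const_mul h (Or.inr hC)
  have h1 := (ENNReal.tendsto_toReal ENNReal.zero_ne_top).comp h0
  refine h1.congr fun N => ?_
  have hm : AEStronglyMeasurable (fun x => φ x - u N x) (volume.restrict (Ioo a b)) :=
    aestronglyMeasurable_jacobiMeasure_iff.mp (hφ.sub (hu N)).1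
  simp only [Function.comp_apply]
  rw [eLpNorm_one_eq_lintegral_enorm, ← integral_norm_eq_lintegral_enorm hm]
  exact integral_congr_ae (.of_forall fun x => abs_sub_comm _ _)

/-- Jacobi coefficients are continuous on `L_p(I,β,γ)`. -/
theorem tendsto_jacobiCoeff_of_tendsto_eLpNorm {a b β γ : ℝ} (hab : a < b) (hβ : -1 < β)
    (hγ : -1 < γ) {q : ENNReal} (hq : 1 ≤ q) {u : ℕ → ℝ → ℝ}
    {φ : ℝ → ℝ} (hu : ∀ N, MemLp (u N) q (jacobiMeasure a b β γ))
    (hφ : MemLp φ q (jacobiMeasure a b β γ))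
    (h : Tendsto (fun N => eLpNorm (fun x => φ x - u N x) q (jacobiMeasure a b β γ)) atTop (𝓝 0))
    (n : ℕ) :
    Tendsto (fun N => jacobiCoeff a b β γ (u N) n) atTop (𝓝 (jacobiCoeff a b β γ φ n)) := by
  have := isFiniteMeasure_jacobiMeasure hab hβ hγ
  have hp := memLp_jacobiP hab hβ hγ n ⊤
  have hmul : ∀ w : ℝ → ℝ, MemLp w q (jacobiMeasure a b β γ) →
      MemLp (fun x => w x * jacobiP a b β γ n x) q (jacobiMeasure a b β γ) := fun w hw => hp.mul hw
  refine tendsto_integral_of_L1' _ ((hmul _ hφ).integrable hq).1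
    (.of_forall fun N => (hmul _ (hu N)).integrable hq) ?_
  set B := eLpNorm (jacobiP a b β γ n) ⊤ (jacobiMeasure a b β γ) *
    jacobiMeasure a b β γ univ ^ (1 / (1 : ENNReal).toReal - 1 / q.toReal)
  have hB : B ≠ ⊤ := by
    refine ENNReal.mul_ne_top hp.2.ne (ENNReal.rpow_ne_top_of_nonneg ?_ (measure_ne_top _ _))
    rcases eq_or_ne q ⊤ with rfl | hqt
    · simp
    · rw [sub_nonneg]
      exact one_div_le_one_div_of_le (by norm_num) (ENNReal.toReal_mono hqt hq)
  refine tendsto_of_tendsto_of_tendsto_of_le_of_le tendsto_const_nhds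
      (h := fun N => B * eLpNorm (fun x => φ x - u N x) q (jacobiMeasure a b β γ)) ?_
      (fun N => zero_le) (fun N => ?_)
  · simpa using ENNReal.Tendsto.const_mul h (Or.inr hB)
  · have hm : AEStronglyMeasurable (fun x => φ x - u N x) (jacobiMeasure a b β γ) :=
      (hφ.sub (hu N)).1
    have e : (fun x => u N x * jacobiP a b β γ n x) - (fun x => φ x * jacobiP a b β γ n x) =
        -(jacobiP a b β γ n • fun x => φ x - u N x) := by
      ext x; simp; ring
    rw [e, eLpNorm_neg]
    refine (eLpNorm_smul_le_mul_eLpNorm (p := ⊤) (q := 1) (r := 1) hm hp.1).trans ?_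
    simp only [B]
    rw [mul_assoc]
    refine mul_le_mul_right ?_ _
    rw [mul_comm]
    exact eLpNorm_le_eLpNorm_mul_rpow_measure_univ hq hm

/-! ### Convergence of Jacobi series -/

theorem ae_eq_of_jacobiCoeff_eq {a b β γ : ℝ} (hab : a < b) (hβ : -1 < β) (hγ : -1 < γ)
    {f g : ℝ → ℝ} (hf : Integrable f (jacobiMeasure a b β γ))
    (hg : Integrable g (jacobiMeasure a b β γ))
    (h : ∀ n, jacobiCoeff a b β γ f n = jacobiCoeff a b β γ g n) :
    f =ᵐ[volume.restrict (Ioo a b)] g := by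
  have hmul : ∀ w : ℝ → ℝ, Integrable w (jacobiMeasure a b β γ) → ∀ n,
      Integrable (fun x => w x * jacobiP a b β γ n x) (jacobiMeasure a b β γ) := fun w hw n => by
    obtain ⟨C, hC⟩ := (isCompact_Icc (a := a) (b := b)).exists_bound_of_continuousOn
      (continuous_jacobiP a b β γ n).continuousOn
    exact Integrable.mul_bdd hw (continuous_jacobiP a b β γ n).aestronglyMeasurable (c := C)
      ((ae_mem_jacobiMeasure a b β γ).mono fun x hx => hC x (Ioo_subset_Icc_self hx))
  have hz := ae_eq_zero_of_integral_mul_jacobiP hab hβ hγ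
    (integrable_jacobiMeasure_iff.mp (hf.sub hg)) fun n => by
      have h0 := sub_eq_zero.mpr (h n)
      unfold jacobiCoeff at h0
      rw [← integral_sub (hmul f hf n) (hmul g hg n), integral_jacobiMeasure] at h0
      rw [← h0]
      refine integral_congr_ae (.of_forall fun x => ?_)
      simp only [Pi.sub_apply]
      ring
  filter_upwards [hz, ae_restrict_mem measurableSet_Ioo] with x hx hxI
  rcases mul_eq_zero.mp hx with h1 | h1
  · exact absurd h1 (jacobiWeight_pos hxI).ne'
  · exact sub_eq_zero.mp h1

theorem sum_smul_toLp_jacobiP {a b β γ : ℝ} (hab : a < b) (hβ : -1 < β) (hγ : -1 < γ)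
    (F : Finset ℕ) (c : ℕ → ℝ) (q : ENNReal) :
    ∑ n ∈ F, c n • (memLp_jacobiP hab hβ hγ n q).toLp =
      (memLp_sum_jacobiP hab hβ hγ F c q).toLp := by
  induction F using Finset.induction_on with
  | empty => simp only [Finset.sum_empty]; rfl
  | insert n F hn ih =>
    rw [Finset.sum_insert hn, ih, ← MemLp.toLp_const_smul, ← MemLp.toLp_add]
    refine MemLp.toLp_congr _ _ (.of_forall fun x => ?_)
    simp only [Pi.add_apply, Pi.smul_apply, smul_eq_mul, Finset.sum_insert hn]

theorem tendsto_eLpNorm_sub_sum_jacobiP {a b β γ : ℝ} (hab : a < b) (hβ : -1 < β) (hγ : -1 < γ)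
    {q : ENNReal} [Fact (1 ≤ q)] {c : ℕ → ℝ} {φ : Lp ℝ q (jacobiMeasure a b β γ)}
    (h : Tendsto (fun N => ∑ n ∈ Finset.range N, c n • (memLp_jacobiP hab hβ hγ n q).toLp) atTop
      (𝓝 φ)) :
    Tendsto (fun N : ℕ => eLpNorm (fun x => φ x - ∑ m ∈ Finset.range N,
      c m * jacobiP a b β γ m x) q (jacobiMeasure a b β γ)) atTop (𝓝 0) := by
  refine ((Lp.tendsto_Lp_iff_tendsto_eLpNorm' _ _).mp h).congr fun N => ?_
  rw [← eLpNorm_neg, sum_smul_toLp_jacobiP hab hβ hγ]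
  refine eLpNorm_congr_ae ?_
  filter_upwards [MemLp.coeFn_toLp (memLp_sum_jacobiP hab hβ hγ (Finset.range N) c q)] with x hx
  simp only [Pi.neg_apply, Pi.sub_apply, hx]
  ring

/-- The Jacobi coefficients of an `L₂` function are square summable and its Jacobi series converges
to it, because the Jacobi polynomials form a Hilbert basis of `L₂(I,β,γ)`. -/
theorem jacobiCoeff_L2 {a b β γ : ℝ} (hab : a < b) (hβ : -1 < β) (hγ : -1 < γ)
    (φ : Lp ℝ 2 (jacobiMeasure a b β γ)) :
    Summable (fun n => jacobiCoeff a b β γ φ n ^ 2) ∧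
    Tendsto (fun N : ℕ => eLpNorm (fun x => φ x - ∑ m ∈ Finset.range N,
      jacobiCoeff a b β γ φ m * jacobiP a b β γ m x) 2 (jacobiMeasure a b β γ)) atTop (𝓝 0) := by
  have := isFiniteMeasure_jacobiMeasure hab hβ hγ
  have hmem := fun n => memLp_jacobiP hab hβ hγ n 2
  set v : ℕ → Lp ℝ 2 (jacobiMeasure a b β γ) := fun n => (hmem n).toLp
  have hin : ∀ n (g : Lp ℝ 2 (jacobiMeasure a b β γ)), inner ℝ (v n) g = jacobiCoeff a b β γ g n := by
    intro n g
    rw [L2.inner_def]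
    refine integral_congr_ae ?_
    filter_upwards [(hmem n).coeFn_toLp] with x hx
    simp only [v, hx]
    rfl
  have horth : Orthonormal ℝ v := by
    rw [orthonormal_iff_ite]
    intro i j
    rw [hin, ← integral_jacobiP_mul_jacobiP hab i j hβ hγ]
    refine integral_congr_ae ?_
    filter_upwards [(hmem j).coeFn_toLp] with x hx
    rw [hx, mul_comm]
  have hbot : (Submodule.span ℝ (Set.range v))ᗮ = ⊥ := by
    rw [Submodule.eq_bot_iff]
    intro g hg
    have h0 : ∀ n, jacobiCoeff a b β γ g n = 0 := fun n => by
      rw [← hin]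
      exact (Submodule.mem_orthogonal _ _).mp hg _ (Submodule.subset_span ⟨n, rfl⟩)
    have h1 : (g : ℝ → ℝ) =ᵐ[volume.restrict (Ioo a b)] fun _ => (0 : ℝ) :=
      ae_eq_of_jacobiCoeff_eq hab hβ hγ ((Lp.memLp g).integrable one_le_two) (integrable_zero _ _ _)
        fun n => by rw [h0]; simp [jacobiCoeff]
    rw [Lp.eq_zero_iff_ae_eq_zero]
    exact ae_jacobiMeasure_iff.mpr h1
  set B := HilbertBasis.mkOfOrthogonalEqBot horth hbot
  have hB : ∀ n, B n = v n := fun n => by simp [B]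
  have hrepr : ∀ n, B.repr φ n = jacobiCoeff a b β γ φ n := fun n => by
    rw [B.repr_apply_apply, hB, hin]
  have hsum := (B.hasSum_repr φ).tendsto_sum_nat
  simp only [hrepr, hB] at hsum
  constructor
  · have h := horth.inner_products_summable φ
    simp only [hin, Real.norm_eq_abs, sq_abs] at h
    exact h
  · exact tendsto_eLpNorm_sub_sum_jacobiP hab hβ hγ hsum

/-- Convergence of a Jacobi series in `L_p`, from the Paley inequality. -/
theorem exists_tendsto_jacobi_series {a b β γ : ℝ} (hab : a < b) (hβ₀ : 0 < β) (hβ₁ : β < 1)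
    (hγ₀ : 0 < γ) (hγ₁ : γ < 1) {p : ℝ} (hp : 2 ≤ p) {c : ℕ → ℝ}
    (hc : Summable fun n : ℕ =>
      |c n| ^ p * ((n : ℝ) + 1) ^ ((max β γ + 1 / 2 + 1) * (p - 2))) :
    ∃ φ : Lp ℝ (ENNReal.ofReal p) (jacobiMeasure a b β γ),
      Tendsto (fun N : ℕ => eLpNorm (fun x => φ x - ∑ m ∈ Finset.range N,
        c m * jacobiP a b β γ m x) (ENNReal.ofReal p) (jacobiMeasure a b β γ)) atTop (𝓝 0) := by
  have hβ : -1 < β := by linarith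
  have hγ : -1 < γ := by linarith
  have hp0 : 0 < p := by linarith
  have := isFiniteMeasure_jacobiMeasure hab hβ hγ
  have : Fact (1 ≤ ENNReal.ofReal p) := ⟨one_le_two.trans (ofReal_two_le hp)⟩
  set q := ENNReal.ofReal p
  set μ := jacobiMeasure a b β γ
  obtain ⟨M, hM, hbd⟩ := exists_abs_jacobiP_le hab hβ₀ hβ₁ hγ₀ hγ₁
  obtain ⟨C, hC, hle⟩ := exists_integral_abs_sum_rpow_le (μ := μ) (e := jacobiP a b β γ)
    (fun n => (continuous_jacobiP a b β γ n).aestronglyMeasurable)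
    (fun n m => integral_jacobiP_mul_jacobiP hab n m hβ hγ) hM
    (σ := max β γ + 1 / 2) (by have := le_max_left β γ; linarith)
    ((ae_mem_jacobiMeasure a b β γ).mono fun x hx n => hbd n x (Ioo_subset_Icc_self hx)) hp
  set v : ℕ → Lp ℝ q μ := fun n => c n • (memLp_jacobiP hab hβ hγ n q).toLp
  have hnorm : ∀ F : Finset ℕ, ‖∑ n ∈ F, v n‖ ^ p ≤
      C * ∑ n ∈ F, |c n| ^ p * ((n : ℝ) + 1) ^ ((max β γ + 1 / 2 + 1) * (p - 2)) := by
    intro F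
    have hint : 0 ≤ ∫ x, |∑ n ∈ F, c n * jacobiP a b β γ n x| ^ p ∂μ :=
      integral_nonneg fun x => Real.rpow_nonneg (abs_nonneg _) _
    refine le_trans (le_of_eq ?_) (hle F c)
    rw [sum_smul_toLp_jacobiP hab hβ hγ, Lp.norm_toLp, MemLp.eLpNorm_eq_integral_rpow_norm
      (by simpa [q] using hp0) ENNReal.ofReal_ne_top (memLp_sum_jacobiP hab hβ hγ F c q)]
    simp only [ENNReal.toReal_ofReal hp0.le, Real.norm_eq_abs]
    rw [ENNReal.toReal_ofReal (Real.rpow_nonneg hint _), ← Real.rpow_mul hint,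
      inv_mul_cancel₀ hp0.ne', Real.rpow_one]
  have hsum : Summable v := by
    rw [summable_iff_vanishing_norm]
    intro ε hε
    obtain ⟨s, hs⟩ := summable_iff_vanishing_norm.mp hc (ε ^ p / (C + 1)) (by positivity)
    refine ⟨s, fun t ht => ?_⟩
    have h1 := hs t ht
    rw [Real.norm_eq_abs, lt_div_iff₀ (by positivity)] at h1
    have h2 := le_abs_self
      (∑ n ∈ t, |c n| ^ p * ((n : ℝ) + 1) ^ ((max β γ + 1 / 2 + 1) * (p - 2)))
    have h3 := abs_nonneg
      (∑ n ∈ t, |c n| ^ p * ((n : ℝ) + 1) ^ ((max β γ + 1 / 2 + 1) * (p - 2)))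
    refine (Real.rpow_lt_rpow_iff (norm_nonneg _) hε.le hp0).mp ((hnorm t).trans_lt ?_)
    nlinarith
  obtain ⟨φ, hφ⟩ := hsum
  exact ⟨φ, tendsto_eLpNorm_sub_sum_jacobiP hab hβ hγ hφ.tendsto_sum_nat⟩

/-! ### The Abel–Sonin equation -/

/-- The exponent `(5/2 + max β γ)(p-2) + 2` is the one of the Paley inequality increased by `p`, which
accounts for the factor `√((n+1)(β+γ+n)) ≤ 2(n+1)`. -/
theorem jacobiS_mul_rpow_le {β γ : ℝ} (hβ₁ : β < 1) (hγ₁ : γ < 1)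
    {p : ℝ} (hp : 2 ≤ p) (g : ℝ) (n : ℕ) :
    |jacobiS β γ n * g| ^ p * ((n : ℝ) + 1) ^ ((max β γ + 1 / 2 + 1) * (p - 2)) ≤
      2 ^ p * (|g| ^ p * ((n : ℝ) + 1) ^ ((5 / 2 + max β γ) * (p - 2) + 2)) := by
  have hn : (0 : ℝ) < (n : ℝ) + 1 := by positivity
  have hs : jacobiS β γ n ≤ 2 * ((n : ℝ) + 1) := by
    unfold jacobiS
    rw [Real.sqrt_le_left (by positivity)]
    nlinarith
  have hs0 : 0 ≤ jacobiS β γ n := Real.sqrt_nonneg _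
  rw [abs_mul, abs_of_nonneg hs0, Real.mul_rpow hs0 (abs_nonneg _)]
  have h1 : jacobiS β γ n ^ p ≤ 2 ^ p * ((n : ℝ) + 1) ^ p := by
    rw [← Real.mul_rpow (by norm_num) hn.le]
    exact Real.rpow_le_rpow hs0 hs (by linarith)
  have h2 : ((n : ℝ) + 1) ^ ((5 / 2 + max β γ) * (p - 2) + 2) =
      ((n : ℝ) + 1) ^ p * ((n : ℝ) + 1) ^ ((max β γ + 1 / 2 + 1) * (p - 2)) := by
    rw [← Real.rpow_add hn]
    congr 1
    ring
  rw [h2]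
  calc _ ≤ 2 ^ p * ((n : ℝ) + 1) ^ p * |g| ^ p *
        ((n : ℝ) + 1) ^ ((max β γ + 1 / 2 + 1) * (p - 2)) := by gcongr
    _ = _ := by ring

theorem exists_solution_of_solvabilityConditions {a b : ℝ} (hab : a < b) {β γ : ℝ}
    (hβ₀ : 0 < β) (hβ₁ : β < 1) (hγ₀ : 0 < γ) (hγ₁ : γ < 1) {ϱ ϑ : ℝ → ℝ}
    (hϱ : IntegrableOn ϱ (Ioo 0 (b - a))) (hϑ : IntegrableOn ϑ (Ioo 0 (b - a)))
    (hSonin : SoninCondition a b ϱ ϑ) {f : ℝ → ℝ} (hf : IntegrableOn f (Ioo a b)) {p : ℝ}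
    (hp : 2 ≤ p) (hsolv : SolvabilityConditions a b β γ ϑ f p) :
    ∃ φ : Lp ℝ (ENNReal.ofReal p) (jacobiMeasure a b β γ), SolvesAbelSonin a b ϱ φ f ∧
      (∀ m : ℕ, jacobiCoeff a b β γ φ m = Real.sqrt (((m : ℝ) + 1) * (β + γ + m)) *
        jacobiCoeff a b (β - 1) (γ - 1) (soninI ϑ a f) (m + 1)) ∧
      Tendsto (fun N : ℕ => eLpNorm (fun x => φ x - ∑ m ∈ Finset.range N,
        jacobiCoeff a b β γ φ m * jacobiP a b β γ m x)
          (ENNReal.ofReal p) (jacobiMeasure a b β γ)) atTop (𝓝 0) := by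
  obtain ⟨hG, hB, hlim⟩ := hsolv
  have hβ' : -1 < β - 1 := by linarith
  have hγ' : -1 < γ - 1 := by linarith
  set G := soninI ϑ a f
  set c : ℕ → ℝ := fun m => jacobiS β γ m * jacobiCoeff a b (β - 1) (γ - 1) G (m + 1)
  have hne : ∀ m, jacobiS β γ m ≠ 0 := fun m => (jacobiS_pos (show 0 < β + γ by linarith) m).ne'
  have hsum : Summable fun n : ℕ =>
      |c n| ^ p * ((n : ℝ) + 1) ^ ((max β γ + 1 / 2 + 1) * (p - 2)) := by
    have h1 := (ENNReal.summable_toReal hB.ne).mul_left ((2 : ℝ) ^ p)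
    refine Summable.of_nonneg_of_le (fun n => by positivity) (fun n => ?_) h1
    rw [ENNReal.toReal_ofReal (by positivity)]
    exact jacobiS_mul_rpow_le hβ₁ hγ₁ hp _ n
  obtain ⟨φ, hφ⟩ := exists_tendsto_jacobi_series hab hβ₀ hβ₁ hγ₀ hγ₁ hp hsum
  have hT := fun N : ℕ => memLp_sum_jacobiP (β := β) (γ := γ) hab (by linarith) (by linarith)
    (Finset.range N) c (ENNReal.ofReal p)
  have hq := ofReal_two_le hp
  have hφi := integrableOn_of_memLp hab hβ₀ hβ₁ hγ₀ hγ₁ hq (Lp.memLp φ)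
  have hco : ∀ m, jacobiCoeff a b β γ φ m = c m := fun m => by
    refine tendsto_nhds_unique (tendsto_jacobiCoeff_of_tendsto_eLpNorm hab (by linarith)
      (by linarith) (one_le_two.trans hq) hT (Lp.memLp φ) hφ m) (tendsto_const_nhds.congr' ?_)
    filter_upwards [eventually_gt_atTop m] with N hN
    rw [jacobiCoeff_sum hab (by linarith) (by linarith) c hN]
  obtain ⟨hΦ, hΦ0⟩ := jacobiCoeff_primitive hab hβ₀ hγ₀ hφi
    (tendsto_integral_abs_of_tendsto_eLpNorm hab hβ₀ hβ₁ hγ₀ hγ₁ hq hT (Lp.memLp φ) hφ)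
  set Φ : ℝ → ℝ := fun x => ∫ t in a..x, φ t
  have hsucc : ∀ m, jacobiCoeff a b (β - 1) (γ - 1) Φ (m + 1) =
      jacobiCoeff a b (β - 1) (γ - 1) G (m + 1) := fun m => by
    rw [hΦ]
    simp only [c]
    field_simp [hne m]
  have hzero : jacobiCoeff a b (β - 1) (γ - 1) Φ 0 = jacobiCoeff a b (β - 1) (γ - 1) G 0 := by
    set p₀ := jacobiP a b (β - 1) (γ - 1) 0 a
    have h1 : Tendsto (fun _ : ℕ => (jacobiCoeff a b (β - 1) (γ - 1) Φ 0 -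
        jacobiCoeff a b (β - 1) (γ - 1) G 0) * p₀) atTop (𝓝 (0 - 0)) := by
      refine ((hΦ0.sub hlim).comp (tendsto_add_atTop_nat 1)).congr fun N => ?_
      simp only [Function.comp_apply]
      rw [Finset.sum_range_succ', Finset.sum_range_succ']
      simp only [hsucc, p₀]
      ring
    have h2 := tendsto_nhds_unique h1 tendsto_const_nhds
    rw [sub_zero, eq_comm] at h2
    exact sub_eq_zero.mp
      ((mul_eq_zero.mp h2).resolve_right (jacobiP_zero_pos hab hβ' hγ' a).ne')
  have hGΦ : G =ᵐ[volume.restrict (Ioo a b)] Φ := by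
    refine ae_eq_of_jacobiCoeff_eq hab hβ' hγ' hG (integrable_primitive hab hβ' hγ' hφi) fun n => ?_
    rcases n with _ | n
    · exact hzero.symm
    · exact (hsucc n).symm
  refine ⟨φ, (solvesAbelSonin_iff hϱ hϑ hSonin hφi hf).mpr hGΦ, hco, ?_⟩
  simp only [hco]
  exact hφ

theorem eq_of_solvesAbelSonin {a b : ℝ} (hab : a < b) {β γ : ℝ}
    (hβ₀ : 0 < β) (hβ₁ : β < 1) (hγ₀ : 0 < γ) (hγ₁ : γ < 1) {ϱ ϑ : ℝ → ℝ}
    (hϱ : IntegrableOn ϱ (Ioo 0 (b - a))) (hϑ : IntegrableOn ϑ (Ioo 0 (b - a)))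
    (hSonin : SoninCondition a b ϱ ϑ) {f : ℝ → ℝ} (hf : IntegrableOn f (Ioo a b)) {q : ENNReal}
    (hq : 2 ≤ q) {φ ψ : Lp ℝ q (jacobiMeasure a b β γ)} (hφ : SolvesAbelSonin a b ϱ φ f)
    (hψ : SolvesAbelSonin a b ϱ ψ f) : φ = ψ := by
  have iφ := integrableOn_of_memLp hab hβ₀ hβ₁ hγ₀ hγ₁ hq (Lp.memLp φ)
  have iψ := integrableOn_of_memLp hab hβ₀ hβ₁ hγ₀ hγ₁ hq (Lp.memLp ψ)
  refine Lp.ext (ae_jacobiMeasure_iff.mpr (ae_eq_of_primitive_ae_eq iφ iψ ?_))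
  filter_upwards [(solvesAbelSonin_iff hϱ hϑ hSonin iφ hf).mp hφ,
    (solvesAbelSonin_iff hϱ hϑ hSonin iψ hf).mp hψ] with x h1 h2
  rw [← h1, ← h2]

/-- For `p = 2` the summability condition is Bessel's inequality for `φ`. -/
theorem solvabilityConditions_of_solvesAbelSonin {a b : ℝ} (hab : a < b) {β γ : ℝ}
    (hβ₀ : 0 < β) (hβ₁ : β < 1) (hγ₀ : 0 < γ) (hγ₁ : γ < 1) {ϱ ϑ : ℝ → ℝ}
    (hϱ : IntegrableOn ϱ (Ioo 0 (b - a))) (hϑ : IntegrableOn ϑ (Ioo 0 (b - a)))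
    (hSonin : SoninCondition a b ϱ ϑ) {f : ℝ → ℝ} (hf : IntegrableOn f (Ioo a b))
    {φ : Lp ℝ 2 (jacobiMeasure a b β γ)} (hφ : SolvesAbelSonin a b ϱ φ f) :
    SolvabilityConditions a b β γ ϑ f 2 := by
  have hβ' : -1 < β - 1 := by linarith
  have hγ' : -1 < γ - 1 := by linarith
  have hφi := integrableOn_of_memLp hab hβ₀ hβ₁ hγ₀ hγ₁ le_rfl (Lp.memLp φ)
  have hG : soninI ϑ a f =ᵐ[volume.restrict (Ioo a b)] fun x => ∫ t in a..x, φ t :=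
    (solvesAbelSonin_iff hϱ hϑ hSonin hφi hf).mp hφ
  obtain ⟨hs, hlim⟩ := jacobiCoeff_L2 (β := β) (γ := γ) hab (by linarith) (by linarith) φ
  obtain ⟨hΦ, hΦ0⟩ := jacobiCoeff_primitive hab hβ₀ hγ₀ hφi
    (tendsto_integral_abs_of_tendsto_eLpNorm hab hβ₀ hβ₁ hγ₀ hγ₁ le_rfl
      (fun N => memLp_sum_jacobiP hab (by linarith) (by linarith) (Finset.range N) _ 2)
      (Lp.memLp φ) hlim)
  have hco := fun n => jacobiCoeff_congr (β := β - 1) (γ := γ - 1) hG n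
  refine ⟨(integrable_primitive hab hβ' hγ' hφi).congr
    (ae_jacobiMeasure_iff.mpr (EventuallyEq.symm hG)), ?_, ?_⟩
  · unfold jacobiB
    refine Summable.tsum_ofReal_lt_top ?_
    refine Summable.of_nonneg_of_le (fun n => by positivity) (fun n => ?_)
      (hs.mul_left (min 1 (β + γ))⁻¹)
    have hκ : 0 < min 1 (β + γ) := lt_min one_pos (by linarith)
    have hn : (0 : ℝ) ≤ n := n.cast_nonneg
    have e : (5 / 2 + max β γ) * ((2 : ℝ) - 2) + 2 = 2 := by ring
    rw [hco, hΦ, e, Real.rpow_ofNat, Real.rpow_ofNat, sq_abs, div_pow,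
      jacobiS_sq (by linarith)]
    -- here `(n+1)(β+γ+n) ≥ min(1, β+γ) (n+1)²`
    have h1 : min 1 (β + γ) * ((n : ℝ) + 1) ≤ β + γ + n := by
      have h2 := min_le_left 1 (β + γ)
      have h3 := min_le_right 1 (β + γ)
      nlinarith
    have hpos : 0 < β + γ + n := by linarith
    rw [div_mul_eq_mul_div, inv_mul_eq_div, div_le_div_iff₀ (by positivity) hκ]
    have h4 : 0 ≤ jacobiCoeff a b β γ φ n ^ 2 * ((n : ℝ) + 1) := by positivity
    nlinarith
  · simpa only [hco] using hΦ0

theorem theorem1 (a b : ℝ) (hab : a < b) (β γ : ℝ)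
    (hβ₀ : 0 < β) (hβ₁ : β < 1) (hγ₀ : 0 < γ) (hγ₁ : γ < 1)
    (ϱ ϑ : ℝ → ℝ) (hϱ : IntegrableOn ϱ (Ioo 0 (b - a))) (hϑ : IntegrableOn ϑ (Ioo 0 (b - a)))
    (hSonin : SoninCondition a b ϱ ϑ)
    (f : ℝ → ℝ) (hf : MemLp f 2 (jacobiMeasure a b β γ)) :
    (∀ p : ℝ, 2 ≤ p → SolvabilityConditions a b β γ ϑ f p →
      (∃! φ : Lp ℝ (ENNReal.ofReal p) (jacobiMeasure a b β γ), SolvesAbelSonin a b ϱ φ f) ∧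
      ∀ φ : Lp ℝ (ENNReal.ofReal p) (jacobiMeasure a b β γ), SolvesAbelSonin a b ϱ φ f →
        (∀ m : ℕ, jacobiCoeff a b β γ φ m =
          Real.sqrt (((m : ℝ) + 1) * (β + γ + m)) *
            jacobiCoeff a b (β - 1) (γ - 1) (soninI ϑ a f) (m + 1)) ∧
        Tendsto (fun N : ℕ => eLpNorm
            (fun x => φ x - ∑ m ∈ Finset.range N,
              jacobiCoeff a b β γ φ m * jacobiP a b β γ m x)
            (ENNReal.ofReal p) (jacobiMeasure a b β γ)) atTop (𝓝 0)) ∧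
    ((∃ φ : Lp ℝ 2 (jacobiMeasure a b β γ), SolvesAbelSonin a b ϱ φ f) ↔
      SolvabilityConditions a b β γ ϑ f 2) := by
  have hfi := integrableOn_of_memLp hab hβ₀ hβ₁ hγ₀ hγ₁ le_rfl hf
  refine ⟨fun p hp hsolv => ?_, ?_, fun hsolv => ?_⟩
  · obtain ⟨φ, hφ, hrest⟩ := exists_solution_of_solvabilityConditions hab hβ₀ hβ₁ hγ₀ hγ₁ hϱ hϑ
      hSonin hfi hp hsolv
    have huniq : ∀ ψ : Lp ℝ (ENNReal.ofReal p) (jacobiMeasure a b β γ),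
        SolvesAbelSonin a b ϱ ψ f → ψ = φ := fun ψ hψ =>
      eq_of_solvesAbelSonin hab hβ₀ hβ₁ hγ₀ hγ₁ hϱ hϑ hSonin hfi (ofReal_two_le hp) hψ hφ
    refine ⟨⟨φ, hφ, huniq⟩, fun ψ hψ => ?_⟩
    rw [huniq ψ hψ]
    exact hrest
  · rintro ⟨φ, hφ⟩
    exact solvabilityConditions_of_solvesAbelSonin hab hβ₀ hβ₁ hγ₀ hγ₁ hϱ hϑ hSonin hfi hφ
  · have h := exists_solution_of_solvabilityConditions hab hβ₀ hβ₁ hγ₀ hγ₁ hϱ hϑ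
      hSonin hfi le_rfl hsolv
    rw [ENNReal.ofReal_ofNat] at h
    exact h.imp fun φ hφ => hφ.1
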